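/- **Lemma 3.1.** Let $n\ge 1$, let $D$ be a compact complex manifold of dimension $n-1$ with a Kähler form $\theta_D$ satisfying $\mathrm{Ric}(\theta_D)=0$, and let $(L,h)$ be a Hermitian holomorphic line bundle over $D$ with $i\Theta(L,h)=\sigma\theta_D$, where $\sigma\in\{-1,1\}$. Put $t=\log\|v\|_h^2$ on the complement of the zero section in the total space of $L$. Let $\varphi_1$ be defined on $(-\infty,0)$ by - if $\sigma=-1$: $\varphi_1(t)=F_-^{-1}(t)$, where $F_-:\mathbb R\to(-\infty,0)$, $F_-(x)=-\int_x^{+\infty}(1+e^u)^{-\frac1{n+1}}\,du$; - if $\sigma=1$: $\varphi_1(t)=F_+^{-1}(-t)$, where $F_+:[0,\infty)\to[0,\infty)$, $F_+(x)=\int_0^x(1-e^{-u})^{-\frac1{n+1}}\,du$. For $\beta>0$ and $t<0$ set $\varphi_\beta(t)=\varphi_1(\beta t)+(n+1)\log\beta$ if $\sigma=-1$ and $\varphi_\beta(t)=\varphi_1(\beta t)$ if $\sigma=1$, and let $\omega_\beta=i\partial\bar\partial\,\varphi_\beta(\log\|v\|_h^2)$ be the resulting Kähler metric on $\{v\in L: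 0<\|v\|_h<1\}$. Let $|R_\beta|$ be the pointwise norm of its curvature tensor, i.e. the least $K\ge 0$ with $|R_\beta(X,\bar Y,Z,\bar W)|\le K\,|X|\,|Y|\,|Z|\,|W|$ for all tangent vectors $X,Y,Z,W$ of type $(1,0)$, lengths being taken with respect to $\omega_\beta$. - If $\sigma=-1$ and $\theta_D$ is flat, there is a constant $C$ such that $|R_\beta|\le C$ at every point with $0<\|v\|_h<1$ and for every $\beta>0$. - If $\sigma=1$, there is a constant $C$ such that, at every point with $0<\|v\|_h<1$ and for every $\beta>0$, $$|R_\beta|\le C\left(\frac{1}{1-e^{-\varphi_\beta}}+\frac{1}{\beta\,(1-e^{-\varphi_\beta})^{\frac1{n+1}}}\right),\qquad \varphi_\beta=\varphi_\beta(\log\|v\|_h^2).$$ The constants may depend on $n$, $D$, $\theta_D$, $L$ and $h$, but not on $\beta$ or on the point. -/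

import Mathlib

open scoped Manifold ContDiff ComplexConjugate
open Bundle

noncomputable section

namespace CalabiModel

/-! ### Complex differential calculus on a finite-dimensional complex vector space -/

section Local

variable {V : Type*} [NormedAddCommGroup V] [NormedSpace ℂ V] [FiniteDimensional ℂ V]

/-- The Wirtinger derivative `∂_X f = ½ (df(X) - i df(iX))`, complex linear in `X`. -/
def dHol (f : V → ℂ) (z X : V) : ℂ :=
  (1 / 2) * (fderiv ℝ f z X - Complex.I * fderiv ℝ f z (Complex.I • X))

/-- The Wirtinger derivative `∂̄_Y f = ½ (df(Y) + i df(iY))`, conjugate linear in `Y`. -/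
def dBar (f : V → ℂ) (z Y : V) : ℂ :=
  (1 / 2) * (fderiv ℝ f z Y + Complex.I * fderiv ℝ f z (Complex.I • Y))

/-- The Hermitian form `(X, Y) ↦ ∑ u_{j k̄} X_j Ȳ_k` of the real `(1,1)`-form `i∂∂̄u`.
Throughout, a real `(1,1)`-form `i ∑ g_{j k̄} dz_j ∧ dz̄_k` is represented by the Hermitian form
`(X, Y) ↦ ∑ g_{j k̄} X_j Ȳ_k`. -/
def ddbar (u : V → ℝ) (z X Y : V) : ℂ :=
  dHol (fun w => dBar (fun w' => (u w' : ℂ)) w Y) z X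

/-- The matrix `(g_{j k̄})` of a field of Hermitian forms in a basis of `V`. -/
def gram (g : V → V → V → ℂ) (z : V) :
    Matrix (Fin (Module.finrank ℂ V)) (Fin (Module.finrank ℂ V)) ℂ :=
  Matrix.of fun j k => g z (Module.finBasis ℂ V j) (Module.finBasis ℂ V k)

/-- The curvature tensor
`R_{i j̄ k l̄} = - ∂_i ∂_j̄ g_{k l̄} + ∑_{p, q} g^{p q̄} ∂_i g_{k q̄} ∂_j̄ g_{p l̄}`
of a Kähler metric `g`, as a form `R(X, Ȳ, Z, W̄)` (linear in `X, Z`, conjugate linear in `Y, W`);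
it is the Chern curvature of the holomorphic tangent bundle. Here
`∑_q g^{p q̄} g_{r q̄} = δ_{pr}`, that is, `g^{p q̄}` is the `(q, p)` entry of the inverse matrix. -/
def curvatureTensor (g : V → V → V → ℂ) (z X Y Z W : V) : ℂ :=
  - dHol (fun w => dBar (fun w' => g w' Z W) w Y) z X
  + ∑ p, ∑ q, (gram g z)⁻¹ q p * dHol (fun w => g w Z (Module.finBasis ℂ V q)) z X
      * dBar (fun w => g w (Module.finBasis ℂ V p) W) z Y

/-- The Hermitian form of the Ricci form `Ric = - i∂∂̄ log det (g_{j k̄})`. -/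
def ricciForm (g : V → V → V → ℂ) (z X Y : V) : ℂ :=
  - ddbar (fun w => Real.log ((gram g w).det).re) z X Y

/-- The length `|X|_g` of a `(1,0)`-vector. -/
def len (g : V → V → V → ℂ) (z X : V) : ℝ := Real.sqrt (g z X X).re

/-- The curvature tensor of `g` at `z` has `g`-norm at most `K`:
`|R(X, Ȳ, Z, W̄)| ≤ K |X| |Y| |Z| |W|` for all `(1,0)`-vectors. -/
def CurvatureLE (g : V → V → V → ℂ) (z : V) (K : ℝ) : Prop :=
  ∀ X Y Z W : V,
    ‖curvatureTensor g z X Y Z W‖ ≤ K * (len g z X * len g z Y * len g z Z * len g z W)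

end Local

/-! ### Kähler metrics on a complex manifold -/

section Kahler

variable (E : Type*) [NormedAddCommGroup E] [NormedSpace ℂ E]
  (D : Type*) [TopologicalSpace D] [ChartedSpace E D]

/-- The expression, in the holomorphic chart at `x`, of a field of sesquilinear forms on the
tangent spaces of `D`. -/
def chartForm {E : Type*} [NormedAddCommGroup E] [NormedSpace ℂ E]
    {D : Type*} [TopologicalSpace D] [ChartedSpace E D]
    (θ : ∀ x : D, TangentSpace 𝓘(ℂ, E) x →ₗ[ℂ] TangentSpace 𝓘(ℂ, E) x →ₗ⋆[ℂ] ℂ)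
    (x : D) (z X Y : E) : ℂ :=
  θ ((chartAt E x).symm z)
    (mfderiv 𝓘(ℂ, E) 𝓘(ℂ, E) (chartAt E x).symm z X)
    (mfderiv 𝓘(ℂ, E) 𝓘(ℂ, E) (chartAt E x).symm z Y)

/-- A Kähler metric on the complex manifold `D`: a smooth field of positive definite Hermitian forms
on the tangent spaces whose `(1,1)`-form is closed (`∂_j g_{k l̄} = ∂_k g_{j l̄}`). -/
structure KahlerMetric where
  form : ∀ x : D, TangentSpace 𝓘(ℂ, E) x →ₗ[ℂ] TangentSpace 𝓘(ℂ, E) x →ₗ⋆[ℂ] ℂ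
  conj_symm : ∀ (x : D) (X Y : TangentSpace 𝓘(ℂ, E) x), conj (form x X Y) = form x Y X
  pos : ∀ (x : D) (X : TangentSpace 𝓘(ℂ, E) x), X ≠ 0 → 0 < (form x X X).re
  smooth : ∀ (x : D) (X Y : E),
    ContDiffOn ℝ ∞ (fun z => chartForm form x z X Y) (chartAt E x).target
  closed : ∀ (x : D), ∀ z ∈ (chartAt E x).target, ∀ X Y Z : E,
    dHol (fun w => chartForm form x w Y Z) z X = dHol (fun w => chartForm form x w X Z) z Y

variable {E D}

/-- `Ric(θ) = 0`. -/
def KahlerMetric.RicciFlat [FiniteDimensional ℂ E] (θ : KahlerMetric E D) : Prop :=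
  ∀ (x : D), ∀ z ∈ (chartAt E x).target, ∀ X Y : E, ricciForm (chartForm θ.form x) z X Y = 0

/-- The curvature tensor of `θ` vanishes. -/
def KahlerMetric.Flat [FiniteDimensional ℂ E] (θ : KahlerMetric E D) : Prop :=
  ∀ (x : D), ∀ z ∈ (chartAt E x).target, ∀ X Y Z W : E,
    curvatureTensor (chartForm θ.form x) z X Y Z W = 0

end Kahler

/-! ### Hermitian holomorphic line bundles -/

section LineBundle

variable (E : Type*) [NormedAddCommGroup E] [NormedSpace ℂ E]
  {D : Type*} [TopologicalSpace D] [ChartedSpace E D]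
  (L : D → Type*) [TopologicalSpace (TotalSpace ℂ L)] [∀ x, AddCommGroup (L x)]
  [∀ x, Module ℂ (L x)] [∀ x, TopologicalSpace (L x)] [FiberBundle ℂ L]

/-- The local frame of `L` given by the trivialization at `x`. -/
def localFrame {D : Type*} [TopologicalSpace D]
    (L : D → Type*) [TopologicalSpace (TotalSpace ℂ L)] [∀ x, AddCommGroup (L x)]
    [∀ x, Module ℂ (L x)] [∀ x, TopologicalSpace (L x)] [FiberBundle ℂ L] (x y : D) : L y :=
  (trivializationAt ℂ L x).symm y 1

/-- The part of the chart at `x` over which the trivialization of `L` at `x` is defined. -/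
def frameDomain (x : D) : Set E :=
  (chartAt E x).target ∩ (chartAt E x).symm ⁻¹' (trivializationAt ℂ L x).baseSet

/-- A smooth Hermitian metric on the line bundle `L`. -/
structure HermitianMetric where
  inner : ∀ x : D, L x →ₗ[ℂ] L x →ₗ⋆[ℂ] ℂ
  conj_symm : ∀ (x : D) (u v : L x), conj (inner x u v) = inner x v u
  pos : ∀ (x : D) (v : L x), v ≠ 0 → 0 < (inner x v v).re
  smooth : ∀ x : D, ContDiffOn ℝ ∞
    (fun z : E => (inner ((chartAt E x).symm z) (localFrame L x ((chartAt E x).symm z))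
      (localFrame L x ((chartAt E x).symm z))).re) (frameDomain E L x)

variable {E L}

/-- The function `v ↦ ‖v‖_h²` on the total space of `L`. -/
def HermitianMetric.normSq (h : HermitianMetric E L) (v : TotalSpace ℂ L) : ℝ :=
  (h.inner v.1 v.2 v.2).re

/-- The Hermitian form of the curvature form `iΘ(L, h) = - i∂∂̄ log ‖e‖_h²`, where `e` is the
holomorphic local frame at `x`, in the chart at `x`. -/
def HermitianMetric.curvatureForm (h : HermitianMetric E L) (x : D) (z X Y : E) : ℂ :=
  - ddbar (fun w : E => Real.log (h.normSq
      ⟨(chartAt E x).symm w, localFrame L x ((chartAt E x).symm w)⟩)) z X Y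

/-- `iΘ(L, h) = σ θ`. -/
def HermitianMetric.CurvatureEq (h : HermitianMetric E L) (σ : ℝ) (θ : KahlerMetric E D) : Prop :=
  ∀ (x : D), ∀ z ∈ frameDomain E L x, ∀ X Y : E,
    h.curvatureForm x z X Y = (σ : ℂ) * chartForm θ.form x z X Y

/-- The function `t = log ‖v‖_h²`. -/
def HermitianMetric.logNormSq (h : HermitianMetric E L) (v : TotalSpace ℂ L) : ℝ :=
  Real.log (h.normSq v)

/-- The metric of the form `ω = i∂∂̄ φ(t)`, `t = log ‖v‖_h²`, in the holomorphic chart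
(with values in `E × ℂ`) of the total space of `L` at the point `v`. -/
def HermitianMetric.calabiForm (h : HermitianMetric E L) (φ : ℝ → ℝ) (v : TotalSpace ℂ L) :
    (E × ℂ) → (E × ℂ) → (E × ℂ) → ℂ :=
  ddbar (fun z : E × ℂ => φ (h.logNormSq ((chartAt (ModelProd E ℂ) v).symm z)))

/-- The curvature at `v` of the metric `ω = i∂∂̄ φ(t)` has `ω`-norm at most `K`. -/
def HermitianMetric.CalabiCurvatureLE [FiniteDimensional ℂ E] (h : HermitianMetric E L)
    (φ : ℝ → ℝ) (v : TotalSpace ℂ L) (K : ℝ) : Prop :=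
  CurvatureLE (h.calabiForm φ v) (chartAt (ModelProd E ℂ) v v) K

end LineBundle

/-! ### The potentials -/

/-- `F₋(x) = - ∫_x^∞ (1 + e^u)^{-1/(n+1)} du`, a bijection `ℝ → (-∞, 0)`. -/
def FNeg (n : ℕ) (x : ℝ) : ℝ :=
  - ∫ u in Set.Ioi x, 1 / (1 + Real.exp u) ^ (1 / ((n : ℝ) + 1))

/-- `F₊(x) = ∫_0^x (1 - e^{-u})^{-1/(n+1)} du`, a bijection `[0, ∞) → [0, ∞)`. -/
def FPos (n : ℕ) (x : ℝ) : ℝ :=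
  ∫ u in (0 : ℝ)..x, 1 / (1 - Real.exp (-u)) ^ (1 / ((n : ℝ) + 1))

/-- `φ₁(t) = F₋⁻¹(t)` for `t < 0`. -/
def phiOneNeg (n : ℕ) (t : ℝ) : ℝ := Function.invFun (FNeg n) t

/-- `φ₁(t) = F₊⁻¹(-t)` for `t < 0`. -/
def phiOnePos (n : ℕ) (t : ℝ) : ℝ := Function.invFunOn (FPos n) (Set.Ici 0) (-t)

/-- The potential `φ_β(t) = φ₁(βt) + (n+1) log β` of the negative case. -/
def phiNeg (n : ℕ) (β t : ℝ) : ℝ := phiOneNeg n (β * t) + ((n : ℝ) + 1) * Real.log β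

/-- The potential `φ_β(t) = φ₁(βt)` of the positive case. -/
def phiPos (n : ℕ) (β t : ℝ) : ℝ := phiOnePos n (β * t)

end CalabiModel

end

noncomputable section

namespace CalabiModel

/-! ### Wirtinger calculus -/

section Wirtinger

variable {V : Type*} [NormedAddCommGroup V] [NormedSpace ℂ V]
variable {V' : Type*} [NormedAddCommGroup V'] [NormedSpace ℂ V']
variable {f g : V → ℂ} {z X Y : V}

/-! Put `s = -σ` and `G = ∂∂̄t`. In a local frame `t = log |w|² + ψ(z)`, and `log |w|²` is
pluriharmonic off the zero section, so `G` is `s` times the pullback of `θ`: it is degenerate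
exactly along the fibres. With `τ = ∂t` and `f = φ'`, the Calabi metric is `f G + f' τ ⊗ τ̄`, an
orthogonal splitting into a base part and a fibre part.

Because `G` kills the fibre direction while `τ` does not, the connection of the metric can be
written down explicitly (`curvatureTensor_ddbar_comp`). The second derivatives of `t` that are not
tensorial cancel. What remains is `f` times the curvature expression of `G`, plus products of `G`
and `τ` with coefficients `f'`, `f'' - f'²/f` and `f''' - f''²/f'`. Since `|f G(X, X)| ≤ |X|²` and
`f' |τ(X)|² ≤ |X|²`, this yields (`calabi_curvatureLE`) `|R| ≤ K/|f| + 2 f'/f² + 4 |f'' - f'²/f| /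
(|f| f') + |f''' - f''²/f'| / f'²`, where `K` bounds the curvature of `θ`.

Both potentials solve one autonomous system with `a = 1/(n+1)`: `f' = a s f² (1 - q)` and `q' = -s q
(1 - q) f`. In it the last three ratios become absolute values of affine functions of `q` alone, so
`β` disappears from them and their sum is at most `(8 + 1/a)(1 + q)` (`IsProfile.exists_derivs`).
For `σ = -1`, `q < 1` and flatness allows `K = 0`. For `σ = 1`, `q = 1/(1 - e^{-φ})` and `|f| = β (1
- e^{-φ})^a`, which are the two terms of the asserted bound.

It remains to find a finite `K`. The curvature tensor is continuous in a fixed chart, its norm is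
invariant under holomorphic coordinate changes (`curvatureTensor_pullback`), and `D` is compact
(`KahlerMetric.exists_curvatureLE`). -/

theorem dHol_congr (h : f =ᶠ[nhds z] g) (X : V) : dHol f z X = dHol g z X := by
  simp only [dHol, h.fderiv_eq]

theorem dBar_congr (h : f =ᶠ[nhds z] g) (X : V) : dBar f z X = dBar g z X := by
  simp only [dBar, h.fderiv_eq]

theorem dHol_add_vec (f : V → ℂ) (z X Y : V) : dHol f z (X + Y) = dHol f z X + dHol f z Y := by
  simp only [dHol, smul_add, map_add]; ring

theorem fderiv_complex_smul (f : V → ℂ) (z : V) (c : ℂ) (X : V) :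
    fderiv ℝ f z (c • X) = c.re * fderiv ℝ f z X + c.im * fderiv ℝ f z (Complex.I • X) := by
  have : c • X = c.re • X + c.im • (Complex.I • X) := by
    conv_lhs => rw [← Complex.re_add_im c]
    rw [add_smul, mul_smul, Complex.coe_smul, Complex.coe_smul]
  rw [this, map_add, map_smul, map_smul, Complex.real_smul, Complex.real_smul]

theorem dHol_smul_vec (f : V → ℂ) (z : V) (c : ℂ) (X : V) :
    dHol f z (c • X) = c * dHol f z X := by
  simp only [dHol, smul_smul, fderiv_complex_smul f z c, fderiv_complex_smul f z (Complex.I * c)]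
  apply Complex.ext <;> simp <;> ring

theorem dBar_smul_vec (f : V → ℂ) (z : V) (c : ℂ) (X : V) :
    dBar f z (c • X) = conj c * dBar f z X := by
  simp only [dBar, smul_smul, fderiv_complex_smul f z c, fderiv_complex_smul f z (Complex.I * c)]
  apply Complex.ext <;> simp <;> ring

theorem dHol_zero_vec (f : V → ℂ) (z : V) : dHol f z 0 = 0 := by simp [dHol]

theorem dHol_add (hf : DifferentiableAt ℝ f z) (hg : DifferentiableAt ℝ g z) (X : V) :
    dHol (fun w => f w + g w) z X = dHol f z X + dHol g z X := by
  simp only [dHol, fderiv_fun_add hf hg, add_apply]; ring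

theorem dBar_add (hf : DifferentiableAt ℝ f z) (hg : DifferentiableAt ℝ g z) (X : V) :
    dBar (fun w => f w + g w) z X = dBar f z X + dBar g z X := by
  simp only [dBar, fderiv_fun_add hf hg, add_apply]; ring

theorem dHol_mul (hf : DifferentiableAt ℝ f z) (hg : DifferentiableAt ℝ g z) (X : V) :
    dHol (fun w => f w * g w) z X = f z * dHol g z X + g z * dHol f z X := by
  simp only [dHol, fderiv_fun_mul hf hg, add_apply,
    smul_apply, smul_eq_mul]; ring

theorem dBar_mul (hf : DifferentiableAt ℝ f z) (hg : DifferentiableAt ℝ g z) (X : V) :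
    dBar (fun w => f w * g w) z X = f z * dBar g z X + g z * dBar f z X := by
  simp only [dBar, fderiv_fun_mul hf hg, add_apply,
    smul_apply, smul_eq_mul]; ring

theorem fderiv_const_mul_complex (c : ℂ) (f : V → ℂ) (z X : V) :
    fderiv ℝ (fun w => c * f w) z X = c * fderiv ℝ f z X := by
  have h : fderiv ℝ (c • f) z = c • fderiv ℝ f z := congrFun (fderiv_const_smul_field c) z
  have h2 : (fun w => c * f w) = c • f := by ext w; simp
  rw [h2, h]; simp

theorem dHol_const_mul (c : ℂ) (f : V → ℂ) (z X : V) :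
    dHol (fun w => c * f w) z X = c * dHol f z X := by
  simp only [dHol, fderiv_const_mul_complex]; ring

theorem dBar_const_mul (c : ℂ) (f : V → ℂ) (z X : V) :
    dBar (fun w => c * f w) z X = c * dBar f z X := by
  simp only [dBar, fderiv_const_mul_complex]; ring

theorem fderiv_conj (f : V → ℂ) (z X : V) :
    fderiv ℝ (fun w => conj (f w)) z X = conj (fderiv ℝ f z X) := by
  have := Complex.conjCLE.comp_fderiv (f := f) (x := z)
  have h2 : (fun w => conj (f w)) = Complex.conjCLE ∘ f := by ext w; simp
  rw [h2, this]; simp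

theorem dHol_conj (f : V → ℂ) (z X : V) :
    dHol (fun w => conj (f w)) z X = conj (dBar f z X) := by
  simp only [dHol, dBar, fderiv_conj, map_mul, map_add, Complex.conj_I]
  simp [sub_eq_add_neg, Complex.conj_ofNat]

theorem dBar_conj (f : V → ℂ) (z X : V) :
    dBar (fun w => conj (f w)) z X = conj (dHol f z X) := by
  simp only [dHol, dBar, fderiv_conj, map_mul, map_sub, Complex.conj_I]
  simp [Complex.conj_ofNat]

theorem dBar_ofReal (t : V → ℝ) (z X : V) :
    dBar (fun w => (t w : ℂ)) z X = conj (dHol (fun w => (t w : ℂ)) z X) := by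
  rw [← dBar_conj]; simp

theorem fderiv_ofReal_comp {t : V → ℝ} {φ : ℝ → ℝ} {φ' : ℝ} (hφ : HasDerivAt φ φ' (t z))
    (ht : DifferentiableAt ℝ t z) (X : V) :
    fderiv ℝ (fun w => (φ (t w) : ℂ)) z X = φ' * fderiv ℝ (fun w => (t w : ℂ)) z X := by
  have h1 := (Complex.ofRealCLM.hasFDerivAt (x := φ (t z))).comp z
    (hφ.comp_hasFDerivAt z ht.hasFDerivAt)
  have h2 := (Complex.ofRealCLM.hasFDerivAt (x := t z)).comp z ht.hasFDerivAt
  have e1 : fderiv ℝ (fun w => (φ (t w) : ℂ)) z = _ := h1.fderiv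
  have e2 : fderiv ℝ (fun w => (t w : ℂ)) z = _ := h2.fderiv
  rw [e1, e2]; simp

theorem dHol_ofReal_comp {t : V → ℝ} {φ : ℝ → ℝ} {φ' : ℝ} (hφ : HasDerivAt φ φ' (t z))
    (ht : DifferentiableAt ℝ t z) (X : V) :
    dHol (fun w => (φ (t w) : ℂ)) z X = φ' * dHol (fun w => (t w : ℂ)) z X := by
  simp only [dHol, fderiv_ofReal_comp hφ ht]; ring

theorem dBar_ofReal_comp {t : V → ℝ} {φ : ℝ → ℝ} {φ' : ℝ} (hφ : HasDerivAt φ φ' (t z))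
    (ht : DifferentiableAt ℝ t z) (X : V) :
    dBar (fun w => (φ (t w) : ℂ)) z X = φ' * dBar (fun w => (t w : ℂ)) z X := by
  simp only [dBar, fderiv_ofReal_comp hφ ht]; ring

theorem fderiv_comp_holomorphic {F : V' → ℂ} {c : V → V'} {c' : V →L[ℂ] V'}
    (hF : DifferentiableAt ℝ F (c z)) (hc : HasFDerivAt c c' z) (X : V) :
    fderiv ℝ (fun w => F (c w)) z X = fderiv ℝ F (c z) (c' X) := by
  have := (hF.hasFDerivAt.comp z (hc.restrictScalars ℝ)).fderiv
  have e : fderiv ℝ (fun w => F (c w)) z = _ := this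
  rw [e]; simp

theorem dHol_comp {F : V' → ℂ} {c : V → V'} {c' : V →L[ℂ] V'}
    (hF : DifferentiableAt ℝ F (c z)) (hc : HasFDerivAt c c' z) (X : V) :
    dHol (fun w => F (c w)) z X = dHol F (c z) (c' X) := by
  simp only [dHol, fderiv_comp_holomorphic hF hc, map_smul]

theorem dBar_comp {F : V' → ℂ} {c : V → V'} {c' : V →L[ℂ] V'}
    (hF : DifferentiableAt ℝ F (c z)) (hc : HasFDerivAt c c' z) (X : V) :
    dBar (fun w => F (c w)) z X = dBar F (c z) (c' X) := by
  simp only [dBar, fderiv_comp_holomorphic hF hc, map_smul]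

theorem dBar_holomorphic {c' : V →L[ℂ] ℂ} (hf : HasFDerivAt f c' z) (X : V) : dBar f z X = 0 := by
  rw [dBar, (hf.restrictScalars ℝ).fderiv]
  simp [← mul_assoc]

theorem dHol_holomorphic {c' : V →L[ℂ] ℂ} (hf : HasFDerivAt f c' z) (X : V) :
    dHol f z X = c' X := by
  rw [dHol, (hf.restrictScalars ℝ).fderiv]
  simp [← mul_assoc]
  ring

theorem contDiffAt_dHol (hf : ContDiffAt ℝ ∞ f z) (X : V) :
    ContDiffAt ℝ ∞ (fun w => dHol f w X) z := by
  have h := hf.fderiv_right (m := ∞) (by simp)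
  unfold dHol
  fun_prop

theorem contDiffAt_dBar (hf : ContDiffAt ℝ ∞ f z) (X : V) :
    ContDiffAt ℝ ∞ (fun w => dBar f w X) z := by
  have h := hf.fderiv_right (m := ∞) (by simp)
  unfold dBar
  fun_prop

theorem _root_.ContDiffAt.differentiableAt_infty {F : Type*} [NormedAddCommGroup F]
    [NormedSpace ℝ F] {f : V → F}
    (hf : ContDiffAt ℝ ∞ f z) : DifferentiableAt ℝ f z :=
  hf.differentiableAt (by simp)

/-- Symmetry of the real second derivative: both sides expand into the same four values of it on
`X`, `iX`, `Y`, `iY`. -/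
theorem dHol_dBar_comm (hf : ContDiffAt ℝ ∞ f z) (X Y : V) :
    dHol (fun w => dBar f w Y) z X = dBar (fun w => dHol f w X) z Y := by
  have hs : IsSymmSndFDerivAt ℝ f z := hf.isSymmSndFDerivAt (by
    simpa using (WithTop.coe_le_coe.2 le_top : ((2 : ℕ∞) : WithTop ℕ∞) ≤ ((⊤ : ℕ∞) : WithTop ℕ∞)))
  have hd : DifferentiableAt ℝ (fderiv ℝ f) z :=
    (hf.fderiv_right (m := ∞) (by simp)).differentiableAt (by simp)
  have h1 : ∀ A B : V, fderiv ℝ (fun w => fderiv ℝ f w A) z B = fderiv ℝ (fderiv ℝ f) z B A := by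
    intro A B
    rw [fderiv_clm_apply hd (by fun_prop)]; simp
  have hda : ∀ A : V, DifferentiableAt ℝ (fun w => fderiv ℝ f w A) z := fun A => by fun_prop
  have h2 : ∀ B, fderiv ℝ (fun w => dBar f w Y) z B = (1/2) * (fderiv ℝ (fderiv ℝ f) z B Y +
      Complex.I * fderiv ℝ (fderiv ℝ f) z B (Complex.I • Y)) := by
    intro B
    unfold dBar
    rw [fderiv_const_mul_complex, fderiv_fun_add (hda _) ((hda _).const_mul _)]
    rw [add_apply, fderiv_const_mul_complex, h1, h1]
  have h3 : ∀ B, fderiv ℝ (fun w => dHol f w X) z B = (1/2) * (fderiv ℝ (fderiv ℝ f) z B X -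
      Complex.I * fderiv ℝ (fderiv ℝ f) z B (Complex.I • X)) := by
    intro B
    unfold dHol
    rw [fderiv_const_mul_complex, fderiv_fun_sub (hda _) ((hda _).const_mul _)]
    rw [sub_apply, fderiv_const_mul_complex, h1, h1]
  rw [dHol, dBar, h2, h2, h3, h3, hs.eq Y X, hs.eq Y (Complex.I • X), hs.eq (Complex.I • Y) X,
    hs.eq (Complex.I • Y) (Complex.I • X)]
  ring

end Wirtinger

/-! ### Hermitian forms and the coordinate-free curvature formula -/

section HermitianForms

variable {V : Type*} [NormedAddCommGroup V] [NormedSpace ℂ V]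

/-- A Hermitian form on `V`, linear in the first variable. -/
structure IsHermForm (g : V → V → ℂ) : Prop where
  add_left : ∀ X X' Y, g (X + X') Y = g X Y + g X' Y
  smul_left : ∀ (c : ℂ) X Y, g (c • X) Y = c * g X Y
  conj_symm : ∀ X Y, conj (g X Y) = g Y X

/-- A positive definite Hermitian form on `V`. -/
structure IsPosHermForm (g : V → V → ℂ) : Prop extends IsHermForm g where
  pos : ∀ X, X ≠ 0 → 0 < (g X X).re

namespace IsHermForm

variable {g : V → V → ℂ} (hg : IsHermForm g)

include hg

theorem add_right (X Y Y' : V) : g X (Y + Y') = g X Y + g X Y' := by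
  rw [← hg.conj_symm, hg.add_left, map_add, hg.conj_symm, hg.conj_symm]

theorem smul_right (c : ℂ) (X Y : V) : g X (c • Y) = conj c * g X Y := by
  rw [← hg.conj_symm, hg.smul_left, map_mul, hg.conj_symm]

theorem zero_left (Y : V) : g 0 Y = 0 := by
  have := hg.smul_left 0 0 Y
  simpa using this

theorem sum_left {ι : Type*} (s : Finset ι) (c : ι → ℂ) (e : ι → V) (Y : V) :
    g (∑ i ∈ s, c i • e i) Y = ∑ i ∈ s, c i * g (e i) Y := by
  classical
  induction s using Finset.induction_on with
  | empty => simpa using hg.zero_left Y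
  | insert a s ha ih => rw [Finset.sum_insert ha, Finset.sum_insert ha, hg.add_left, hg.smul_left, ih]

theorem sum_right {ι : Type*} (s : Finset ι) (c : ι → ℂ) (e : ι → V) (X : V) :
    g X (∑ i ∈ s, c i • e i) = ∑ i ∈ s, conj (c i) * g X (e i) := by
  rw [← hg.conj_symm, hg.sum_left, map_sum]
  simp [hg.conj_symm]

theorem im_self (X : V) : (g X X).im = 0 := by
  have := congrArg Complex.im (hg.conj_symm X X)
  simp at this
  linarith

theorem self_eq (X : V) : g X X = ((g X X).re : ℂ) := by
  apply Complex.ext <;> simp [hg.im_self]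

/-- The Cauchy-Schwarz inequality. -/
theorem norm_le (hnn : ∀ X, 0 ≤ (g X X).re) (X Y : V) :
    ‖g X Y‖ ≤ Real.sqrt (g X X).re * Real.sqrt (g Y Y).re := by
  -- Nonnegativity at `Y + c g(Y, X) X`. Only semidefiniteness is assumed, because the inequality is
  -- needed for `f G`, which has a kernel.
  have key : ∀ c : ℝ, 0 ≤ (g Y Y).re + 2 * c * ‖g X Y‖ ^ 2 + c ^ 2 * ‖g X Y‖ ^ 2 * (g X X).re := by
    intro c
    have h := hnn (Y + ((c : ℂ) * g Y X) • X)
    have e : g (Y + ((c : ℂ) * g Y X) • X) (Y + ((c : ℂ) * g Y X) • X)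
        = ((g Y Y).re + 2 * c * ‖g X Y‖ ^ 2 + c ^ 2 * ‖g X Y‖ ^ 2 * (g X X).re : ℝ) := by
      rw [hg.add_left, hg.add_right, hg.add_right, hg.smul_left, hg.smul_left, hg.smul_right,
        hg.smul_right, ← hg.conj_symm X Y]
      simp only [map_mul, Complex.conj_conj, Complex.conj_ofReal]
      rw [hg.self_eq X, hg.self_eq Y]
      have : (conj (g X Y)) * g X Y = ((‖g X Y‖ ^ 2 : ℝ) : ℂ) := by
        rw [Complex.conj_mul']; simp
      push_cast at this ⊢
      simp only [Complex.ofReal_re]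
      linear_combination (2 * (c : ℂ) + c ^ 2 * ((g X X).re : ℂ)) * this
    rw [e, Complex.ofReal_re] at h
    exact h
  rw [← Real.sqrt_mul (hnn X)]
  apply Real.le_sqrt_of_sq_le
  rcases eq_or_lt_of_le (sq_nonneg ‖g X Y‖) with h0 | h0
  · rw [← h0]; exact mul_nonneg (hnn X) (hnn Y)
  · rcases eq_or_lt_of_le (hnn X) with hx | hx
    -- For a null vector `X` the inequality is affine in `c`; this `c` makes its right-hand side
    -- `-1`.
    · have := key (-((g Y Y).re + 1) / (2 * ‖g X Y‖ ^ 2))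
      rw [← hx] at this
      have e : 2 * (-((g Y Y).re + 1) / (2 * ‖g X Y‖ ^ 2)) * ‖g X Y‖ ^ 2 = -((g Y Y).re + 1) := by
        have hne : ‖g X Y‖ ≠ 0 := fun h => by simp [h] at h0
        field_simp
      rw [e] at this
      linarith
    · have := key (-1 / (g X X).re)
      have e : (g Y Y).re + 2 * (-1 / (g X X).re) * ‖g X Y‖ ^ 2 +
          (-1 / (g X X).re) ^ 2 * ‖g X Y‖ ^ 2 * (g X X).re
          = ((g X X).re * (g Y Y).re - ‖g X Y‖ ^ 2) / (g X X).re := by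
        field_simp; ring
      rw [e, le_div_iff₀ hx] at this
      linarith

end IsHermForm

theorem IsPosHermForm.nonneg {g : V → V → ℂ} (hg : IsPosHermForm g) (X : V) : 0 ≤ (g X X).re := by
  by_cases h : X = 0
  · rw [h, hg.zero_left]; simp
  · exact (hg.pos X h).le

variable [FiniteDimensional ℂ V]

namespace IsPosHermForm

variable {g : V → V → V → ℂ} {z : V} (hg : IsPosHermForm (g z))

include hg

/-- A row vector in the left kernel gives a vector `Γ` orthogonal to the whole basis, hence to
itself, contradicting positivity. -/
theorem isUnit_det_gram : IsUnit (gram g z).det := by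
  rw [isUnit_iff_ne_zero]
  intro h0
  obtain ⟨c, hc0, hc⟩ := Matrix.exists_vecMul_eq_zero_iff.2 h0
  set Γ : V := ∑ i, c i • Module.finBasis ℂ V i with hΓ
  have h1 : ∀ q, g z Γ (Module.finBasis ℂ V q) = 0 := by
    intro q
    rw [hΓ, hg.sum_left]
    have := congrFun hc q
    simpa [Matrix.vecMul, dotProduct, gram] using this
  have h2 : g z Γ Γ = 0 := by
    conv_lhs => rw [hΓ]; arg 3; rw [← hΓ]
    conv_lhs => arg 3; rw [hΓ]
    rw [hg.sum_right]
    apply Finset.sum_eq_zero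
    intro i _
    rw [← hΓ, h1, mul_zero]
  have h3 : Γ = 0 := by
    by_contra h
    have := hg.pos Γ h
    rw [h2] at this
    simp at this
  apply hc0
  funext i
  exact (Fintype.linearIndependent_iff.1 (Module.finBasis ℂ V).linearIndependent) c h3 i

/-- Every conjugate linear functional is represented by a vector. -/
theorem exists_repr (ℓ : V → ℂ) (hadd : ∀ X Y, ℓ (X + Y) = ℓ X + ℓ Y)
    (hsmul : ∀ (c : ℂ) X, ℓ (c • X) = conj c * ℓ X) : ∃ Γ : V, ∀ W, g z Γ W = ℓ W := by
  set b := Module.finBasis ℂ V with hb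
  set c := Matrix.vecMul (fun q => ℓ (b q)) (gram g z)⁻¹ with hc
  have hcM : Matrix.vecMul c (gram g z) = fun q => ℓ (b q) := by
    rw [hc, Matrix.vecMul_vecMul, Matrix.nonsing_inv_mul _ hg.isUnit_det_gram, Matrix.vecMul_one]
  refine ⟨∑ i, c i • b i, fun W => ?_⟩
  have h1 : ∀ q, g z (∑ i, c i • b i) (b q) = ℓ (b q) := by
    intro q
    rw [hg.sum_left]
    have := congrFun hcM q
    simpa [Matrix.vecMul, dotProduct, gram] using this
  have hl0 : ℓ 0 = 0 := by simpa using hsmul 0 0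
  have hsum : ∀ s : Finset (Fin (Module.finrank ℂ V)),
      ℓ (∑ i ∈ s, b.repr W i • b i) = ∑ i ∈ s, conj (b.repr W i) * ℓ (b i) := by
    intro s
    classical
    induction s using Finset.induction_on with
    | empty => simpa using hl0
    | insert a s ha ih => rw [Finset.sum_insert ha, Finset.sum_insert ha, hadd, hsmul, ih]
  conv_lhs => rw [← b.sum_repr W]
  conv_rhs => rw [← b.sum_repr W]
  rw [hg.sum_right, hsum]
  simp only [h1]

/-- The curvature tensor, expressed through vectors representing the first derivatives of the
metric. -/
theorem curvatureTensor_eq {X Y Z W Γ₁ Γ₂ : V}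
    (h₁ : ∀ Q, g z Γ₁ Q = dHol (fun w => g w Z Q) z X)
    (h₂ : ∀ P, g z P Γ₂ = dBar (fun w => g w P W) z Y) :
    curvatureTensor g z X Y Z W =
      - dHol (fun w => dBar (fun w' => g w' Z W) w Y) z X + g z Γ₁ Γ₂ := by
  set b := Module.finBasis ℂ V with hb
  have hdet := hg.isUnit_det_gram
  have hc : Matrix.vecMul (fun i => b.repr Γ₁ i) (gram g z) = fun q => g z Γ₁ (b q) := by
    funext q
    conv_rhs => rw [← b.sum_repr Γ₁]
    rw [hg.sum_left]
    simp [Matrix.vecMul, dotProduct, gram, hb]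
  -- Multiplying the values `g(Γ₁, b_q)` by the inverse Gram matrix recovers the coordinates of
  -- `Γ₁`, so the double sum in the curvature collapses to `g(Γ₁, Γ₂)`.
  have hc2 : Matrix.vecMul (fun q => g z Γ₁ (b q)) (gram g z)⁻¹ = fun i => b.repr Γ₁ i := by
    rw [← hc, Matrix.vecMul_vecMul, Matrix.mul_nonsing_inv _ hdet, Matrix.vecMul_one]
  rw [curvatureTensor]
  congr 1
  simp only [← h₁, ← h₂, ← hb]
  conv_rhs => rw [← b.sum_repr Γ₁]
  rw [hg.sum_left]
  refine Finset.sum_congr rfl fun p _ => ?_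
  rw [← congrFun hc2 p]
  simp only [Matrix.vecMul, dotProduct, Finset.sum_mul]
  refine Finset.sum_congr rfl fun q _ => ?_
  ring

end IsPosHermForm

end HermitianForms

/-! ### Derivatives of `∂∂̄φ(t)` -/

section Calabi

variable {V : Type*} [NormedAddCommGroup V] [NormedSpace ℂ V]

/-- `F` is real differentiable at `z` with `∂_X F = a`. -/
structure HasDHol (F : V → ℂ) (z X : V) (a : ℂ) : Prop where
  diff : DifferentiableAt ℝ F z
  eq : dHol F z X = a

/-- `F` is real differentiable at `z` with `∂̄_X F = a`. -/
structure HasDBar (F : V → ℂ) (z X : V) (a : ℂ) : Prop where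
  diff : DifferentiableAt ℝ F z
  eq : dBar F z X = a

variable {F F' : V → ℂ} {z X : V} {a b : ℂ}

theorem HasDHol.add (h : HasDHol F z X a) (h' : HasDHol F' z X b) :
    HasDHol (fun w => F w + F' w) z X (a + b) :=
  ⟨h.diff.add h'.diff, by rw [dHol_add h.diff h'.diff, h.eq, h'.eq]⟩

theorem HasDHol.mul (h : HasDHol F z X a) (h' : HasDHol F' z X b) :
    HasDHol (fun w => F w * F' w) z X (F z * b + F' z * a) :=
  ⟨h.diff.mul h'.diff, by rw [dHol_mul h.diff h'.diff, h.eq, h'.eq]⟩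

theorem HasDBar.add (h : HasDBar F z X a) (h' : HasDBar F' z X b) :
    HasDBar (fun w => F w + F' w) z X (a + b) :=
  ⟨h.diff.add h'.diff, by rw [dBar_add h.diff h'.diff, h.eq, h'.eq]⟩

theorem HasDBar.mul (h : HasDBar F z X a) (h' : HasDBar F' z X b) :
    HasDBar (fun w => F w * F' w) z X (F z * b + F' z * a) :=
  ⟨h.diff.mul h'.diff, by rw [dBar_mul h.diff h'.diff, h.eq, h'.eq]⟩

theorem _root_.ContDiffAt.hasDHol (h : ContDiffAt ℝ ∞ F z) (X : V) :
    HasDHol F z X (dHol F z X) := ⟨h.differentiableAt_infty, rfl⟩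

theorem _root_.ContDiffAt.hasDBar (h : ContDiffAt ℝ ∞ F z) (X : V) :
    HasDBar F z X (dBar F z X) := ⟨h.differentiableAt_infty, rfl⟩

theorem differentiableAt_ofReal_comp {t : V → ℝ} {φ : ℝ → ℝ} {φ' : ℝ}
    (hφ : HasDerivAt φ φ' (t z)) (ht : DifferentiableAt ℝ t z) :
    DifferentiableAt ℝ (fun w => (φ (t w) : ℂ)) z :=
  ((Complex.ofRealCLM.hasFDerivAt (x := φ (t z))).comp z
    (hφ.comp_hasFDerivAt z ht.hasFDerivAt)).differentiableAt

theorem hasDHol_ofReal_comp {t : V → ℝ} {φ : ℝ → ℝ} {φ' : ℝ} (hφ : HasDerivAt φ φ' (t z))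
    (ht : DifferentiableAt ℝ t z) (X : V) :
    HasDHol (fun w => (φ (t w) : ℂ)) z X (φ' * dHol (fun w => (t w : ℂ)) z X) :=
  ⟨differentiableAt_ofReal_comp hφ ht, dHol_ofReal_comp hφ ht X⟩

theorem hasDBar_ofReal_comp {t : V → ℝ} {φ : ℝ → ℝ} {φ' : ℝ} (hφ : HasDerivAt φ φ' (t z))
    (ht : DifferentiableAt ℝ t z) (X : V) :
    HasDBar (fun w => (φ (t w) : ℂ)) z X (φ' * dBar (fun w => (t w : ℂ)) z X) :=
  ⟨differentiableAt_ofReal_comp hφ ht, dBar_ofReal_comp hφ ht X⟩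

theorem _root_.ContDiffAt.ofReal_complex {t : V → ℝ} (ht : ContDiffAt ℝ ∞ t z) :
    ContDiffAt ℝ ∞ (fun w => (t w : ℂ)) z :=
  Complex.ofRealCLM.contDiff.contDiffAt.comp z ht

theorem dBar_dHol_ofReal {t : V → ℝ} (ht : ContDiffAt ℝ ∞ t z) (X Y : V) :
    dBar (fun w => dHol (fun w' => (t w' : ℂ)) w X) z Y = ddbar t z X Y :=
  (dHol_dBar_comm ht.ofReal_complex X Y).symm

theorem isHermForm_ddbar {t : V → ℝ} (ht : ContDiffAt ℝ ∞ t z) : IsHermForm (ddbar t z) where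
  add_left X X' Y := dHol_add_vec _ _ _ _
  smul_left c X Y := dHol_smul_vec _ _ _ _
  conj_symm X Y := by
    rw [← dBar_dHol_ofReal ht, ddbar, ← dHol_conj]
    congr 1
    funext w
    rw [dBar_ofReal]

/-- The real `(1,1)`-form `f(t) i∂∂̄t + f'(t) i∂t ∧ ∂̄t`. -/
theorem ddbar_comp {t : V → ℝ} {φ f : ℝ → ℝ} {f₁ : ℝ} (htd : ∀ᶠ w in nhds z, ContDiffAt ℝ ∞ t w)
    (hφ : ∀ᶠ s in nhds (t z), HasDerivAt φ (f s) s) (hf : HasDerivAt f f₁ (t z)) (X Y : V) :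
    ddbar (fun w => φ (t w)) z X Y = f (t z) * ddbar t z X Y
      + dBar (fun w => (t w : ℂ)) z Y * (f₁ * dHol (fun w => (t w : ℂ)) z X) := by
  have ht := htd.self_of_nhds
  have h1 : (fun w => dBar (fun w' => (φ (t w') : ℂ)) w Y) =ᶠ[nhds z]
      fun w => (f (t w) : ℂ) * dBar (fun w => (t w : ℂ)) w Y := by
    filter_upwards [htd, ht.continuousAt.eventually hφ] with w hw hw'
    exact dBar_ofReal_comp hw' hw.differentiableAt_infty Y
  rw [ddbar, dHol_congr h1]
  rw [((hasDHol_ofReal_comp hf ht.differentiableAt_infty X).mul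
    ((contDiffAt_dBar ht.ofReal_complex Y).hasDHol X)).eq]
  rfl

theorem contDiffAt_ddbar {t : V → ℝ} (ht : ContDiffAt ℝ ∞ t z) (X Y : V) :
    ContDiffAt ℝ ∞ (fun w => ddbar t w X Y) z :=
  contDiffAt_dHol (contDiffAt_dBar ht.ofReal_complex Y) X

section Derivatives

variable {t : V → ℝ} {φ f f₁ f₂ : ℝ → ℝ} {f₃ : ℝ}

local notation "τ" => dHol (fun w => (t w : ℂ))
local notation "τb" => dBar (fun w => (t w : ℂ))

/-- Product rule applied to `f G + f₁ τ τ̄`. The mixed derivative of `t` is again `G`; the only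
non-tensorial second derivative is `∂_X ∂_Z t`, kept so that it can cancel in the curvature. -/
theorem dHol_ddbar_comp (htd : ∀ᶠ w in nhds z, ContDiffAt ℝ ∞ t w)
    (hφ : ∀ᶠ s in nhds (t z), HasDerivAt φ (f s) s)
    (hf : ∀ᶠ s in nhds (t z), HasDerivAt f (f₁ s) s)
    (hf₁ : HasDerivAt f₁ (f₂ (t z)) (t z)) (X Z W : V) :
    dHol (fun w => ddbar (fun w' => φ (t w')) w Z W) z X =
      f (t z) * dHol (fun w => ddbar t w Z W) z X + f₁ (t z) * τ z X * ddbar t z Z W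
      + f₂ (t z) * τ z X * τ z Z * τb z W + f₁ (t z) * τ z Z * ddbar t z X W
      + f₁ (t z) * dHol (fun w => τ w Z) z X * τb z W := by
  have ht := htd.self_of_nhds
  have h1 : (fun w => ddbar (fun w' => φ (t w')) w Z W) =ᶠ[nhds z]
      fun w => f (t w) * ddbar t w Z W + τb w W * (f₁ (t w) * τ w Z) := by
    filter_upwards [htd.eventually_nhds, ht.continuousAt.eventually hφ.eventually_nhds,
      ht.continuousAt.eventually hf] with w hw hw' hw''
    exact ddbar_comp hw hw' hw'' Z W
  rw [dHol_congr h1]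
  have td := ht.differentiableAt_infty
  rw [(((hasDHol_ofReal_comp hf.self_of_nhds td X).mul
    ((contDiffAt_ddbar ht Z W).hasDHol X)).add
    (((contDiffAt_dBar ht.ofReal_complex W).hasDHol X).mul ((hasDHol_ofReal_comp hf₁ td X).mul
      ((contDiffAt_dHol ht.ofReal_complex Z).hasDHol X)))).eq]
  have e : dHol (fun w => τb w W) z X = ddbar t z X W := rfl
  rw [e]
  ring

theorem dBar_ddbar_comp (htd : ∀ᶠ w in nhds z, ContDiffAt ℝ ∞ t w)
    (hφ : ∀ᶠ s in nhds (t z), HasDerivAt φ (f s) s)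
    (hf : ∀ᶠ s in nhds (t z), HasDerivAt f (f₁ s) s)
    (hf₁ : HasDerivAt f₁ (f₂ (t z)) (t z)) (Y Z W : V) :
    dBar (fun w => ddbar (fun w' => φ (t w')) w Z W) z Y =
      f (t z) * dBar (fun w => ddbar t w Z W) z Y + f₁ (t z) * τb z Y * ddbar t z Z W
      + f₂ (t z) * τb z Y * τ z Z * τb z W + f₁ (t z) * ddbar t z Z Y * τb z W
      + f₁ (t z) * τ z Z * dBar (fun w => τb w W) z Y := by
  have ht := htd.self_of_nhds
  have h1 : (fun w => ddbar (fun w' => φ (t w')) w Z W) =ᶠ[nhds z]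
      fun w => f (t w) * ddbar t w Z W + τb w W * (f₁ (t w) * τ w Z) := by
    filter_upwards [htd.eventually_nhds, ht.continuousAt.eventually hφ.eventually_nhds,
      ht.continuousAt.eventually hf] with w hw hw' hw''
    exact ddbar_comp hw hw' hw'' Z W
  rw [dBar_congr h1]
  have td := ht.differentiableAt_infty
  rw [(((hasDBar_ofReal_comp hf.self_of_nhds td Y).mul
    ((contDiffAt_ddbar ht Z W).hasDBar Y)).add
    (((contDiffAt_dBar ht.ofReal_complex W).hasDBar Y).mul ((hasDBar_ofReal_comp hf₁ td Y).mul
      ((contDiffAt_dHol ht.ofReal_complex Z).hasDBar Y)))).eq]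
  rw [dBar_dHol_ofReal ht]
  ring

theorem dHol_dBar_ddbar_comp (htd : ∀ᶠ w in nhds z, ContDiffAt ℝ ∞ t w)
    (hφ : ∀ᶠ s in nhds (t z), HasDerivAt φ (f s) s)
    (hf : ∀ᶠ s in nhds (t z), HasDerivAt f (f₁ s) s)
    (hf₁ : ∀ᶠ s in nhds (t z), HasDerivAt f₁ (f₂ s) s)
    (hf₂ : HasDerivAt f₂ f₃ (t z)) (X Y Z W : V) :
    dHol (fun w => dBar (fun w => ddbar (fun w' => φ (t w')) w Z W) w Y) z X =
      f (t z) * dHol (fun w => dBar (fun w => ddbar t w Z W) w Y) z X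
      + f₁ (t z) * (τ z X * dBar (fun w => ddbar t w Z W) z Y
        + τb z Y * dHol (fun w => ddbar t w Z W) z X
        + τb z W * dHol (fun w => ddbar t w Z Y) z X
        + τ z Z * dBar (fun w => ddbar t w X W) z Y
        + ddbar t z X Y * ddbar t z Z W + ddbar t z Z Y * ddbar t z X W
        + dHol (fun w => τ w Z) z X * dBar (fun w => τb w W) z Y)
      + f₂ (t z) * (τ z X * τb z Y * ddbar t z Z W + ddbar t z X Y * τ z Z * τb z W
        + ddbar t z X W * τb z Y * τ z Z + τ z X * ddbar t z Z Y * τb z W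
        + dHol (fun w => τ w Z) z X * τb z Y * τb z W
        + τ z X * τ z Z * dBar (fun w => τb w W) z Y)
      + f₃ * (τ z X * τb z Y * τ z Z * τb z W) := by
  have ht := htd.self_of_nhds
  have h1 : (fun w => dBar (fun w => ddbar (fun w' => φ (t w')) w Z W) w Y) =ᶠ[nhds z]
      fun w => f (t w) * dBar (fun w => ddbar t w Z W) w Y
      + f₁ (t w) * (τb w Y * ddbar t w Z W + ddbar t w Z Y * τb w W
         + τ w Z * dBar (fun w => τb w W) w Y)
      + f₂ (t w) * (τb w Y * (τ w Z * τb w W)) := by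
    filter_upwards [htd.eventually_nhds, ht.continuousAt.eventually hφ.eventually_nhds,
      ht.continuousAt.eventually hf.eventually_nhds, ht.continuousAt.eventually hf₁]
      with w hw hw' hw'' hw3
    rw [dBar_ddbar_comp hw hw' hw'' hw3 Y Z W]
    ring
  rw [dHol_congr h1]
  have td := ht.differentiableAt_infty
  have hτ := (contDiffAt_dHol ht.ofReal_complex Z).hasDHol X
  have hτY := (contDiffAt_dBar ht.ofReal_complex Y).hasDHol X
  have hτW := (contDiffAt_dBar ht.ofReal_complex W).hasDHol X
  have hG := (contDiffAt_ddbar ht Z W).hasDHol X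
  have hG' := (contDiffAt_ddbar ht Z Y).hasDHol X
  have hGb := (contDiffAt_dBar (contDiffAt_ddbar ht Z W) Y).hasDHol X
  have hS := (contDiffAt_dBar (contDiffAt_dBar ht.ofReal_complex W) Y).hasDHol X
  rw [((((hasDHol_ofReal_comp hf.self_of_nhds td X).mul hGb).add
    ((hasDHol_ofReal_comp hf₁.self_of_nhds td X).mul
      (((hτY.mul hG).add (hG'.mul hτW)).add (hτ.mul hS)))).add
      ((hasDHol_ofReal_comp hf₂ td X).mul (hτY.mul (hτ.mul hτW)))).eq]
  have e : ∀ W, dHol (fun w => τb w W) z X = ddbar t z X W := fun _ => rfl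
  -- Commuting `∂_X` past `∂̄_Y` turns this third derivative of `t` into a first derivative of `G`.
  have e2 : dHol (fun w => dBar (fun w => τb w W) w Y) z X = dBar (fun w => ddbar t w X W) z Y := by
    rw [dHol_dBar_comm (contDiffAt_dBar ht.ofReal_complex W)]
    rfl
  rw [e, e, e2]
  ring

end Derivatives

end Calabi

/-! ### Curvature of the Calabi ansatz -/

section CalabiCurvature

variable {V : Type*} [NormedAddCommGroup V] [NormedSpace ℂ V]
variable {z : V} {t : V → ℝ} {φ f f₁ f₂ : ℝ → ℝ} {f₃ : ℝ}

theorem dBar_eq_conj_dHol_of_isHermForm {g : V → V → V → ℂ} (hg : ∀ᶠ w in nhds z, IsHermForm (g w))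
    (Y P W : V) : dBar (fun w => g w P W) z Y = conj (dHol (fun w => g w W P) z Y) := by
  rw [← dBar_conj]
  apply dBar_congr
  filter_upwards [hg] with w hw
  exact (hw.conj_symm W P).symm

/-- Symmetry is read off from the expansion `f G + f₁ τ τ̄`: commuting derivatives as for `t` would
need `φ ∘ t` smooth, whereas `φ` is only assumed to have the derivatives listed. -/
theorem isHermForm_ddbar_comp (htd : ∀ᶠ w in nhds z, ContDiffAt ℝ ∞ t w)
    (hφ : ∀ᶠ s in nhds (t z), HasDerivAt φ (f s) s) (hf : HasDerivAt f (f₁ (t z)) (t z)) :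
    IsHermForm (ddbar (fun w => φ (t w)) z) where
  add_left X X' Y := dHol_add_vec _ _ _ _
  smul_left c X Y := dHol_smul_vec _ _ _ _
  conj_symm X Y := by
    rw [ddbar_comp htd hφ hf, ddbar_comp htd hφ hf]
    simp only [map_add, map_mul, Complex.conj_ofReal, dBar_ofReal, Complex.conj_conj]
    rw [(isHermForm_ddbar htd.self_of_nhds).conj_symm]
    ring

local notation "τ" => dHol (fun w => (t w : ℂ)) z
local notation "G" => ddbar t z

variable [FiniteDimensional ℂ V]

/-- The curvature tensor of `i∂∂̄φ(t)`, when `i∂∂̄t` is degenerate in the direction `ν`. Here `Γ` is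
the connection of `i∂∂̄t`. -/
theorem curvatureTensor_ddbar_comp (htd : ∀ᶠ w in nhds z, ContDiffAt ℝ ∞ t w)
    (hφ : ∀ᶠ s in nhds (t z), HasDerivAt φ (f s) s)
    (hf : ∀ᶠ s in nhds (t z), HasDerivAt f (f₁ s) s)
    (hf₁ : ∀ᶠ s in nhds (t z), HasDerivAt f₁ (f₂ s) s)
    (hf₂ : HasDerivAt f₂ f₃ (t z))
    (hpos : IsPosHermForm (ddbar (fun w => φ (t w)) z))
    {ν : V} (hν : τ ν = 1) (hGν : ∀ W, G ν W = 0) {Γ : V → V → V}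
    (hΓ : ∀ X Z W, G (Γ X Z) W = dHol (fun w => ddbar t w Z W) z X)
    (h0 : f (t z) ≠ 0) (h1 : f₁ (t z) ≠ 0) (X Y Z W : V) :
    curvatureTensor (ddbar (fun w => φ (t w))) z X Y Z W =
      f (t z) * (- dHol (fun w => dBar (fun w => ddbar t w Z W) w Y) z X + G (Γ X Z) (Γ Y W))
      - f₁ (t z) * (G X Y * G Z W + G Z Y * G X W)
      - ((f₂ (t z) - f₁ (t z) ^ 2 / f (t z) : ℝ) : ℂ) *
        (τ X * conj (τ Y) * G Z W + G X Y * τ Z * conj (τ W)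
          + G X W * conj (τ Y) * τ Z + τ X * G Z Y * conj (τ W))
      - ((f₃ - f₂ (t z) ^ 2 / f₁ (t z) : ℝ) : ℂ) * (τ X * conj (τ Y) * τ Z * conj (τ W)) := by
  have ht := htd.self_of_nhds
  have hG := isHermForm_ddbar ht
  have hGn : ∀ᶠ w in nhds z, IsHermForm (ddbar t w) := htd.mono fun w hw => isHermForm_ddbar hw
  have hgn : ∀ᶠ w in nhds z, IsHermForm (ddbar (fun w' => φ (t w')) w) := by
    filter_upwards [htd.eventually_nhds, ht.continuousAt.eventually hφ.eventually_nhds,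
      ht.continuousAt.eventually hf] with w hw hw' hw''
    exact isHermForm_ddbar_comp hw hw' hw''
  have hgf : ∀ X Y, ddbar (fun w' => φ (t w')) z X Y
      = f (t z) * G X Y + conj (τ Y) * (f₁ (t z) * τ X) := by
    intro X Y
    rw [ddbar_comp htd hφ hf.self_of_nhds, dBar_ofReal]
  have h0c : (f (t z) : ℂ) ≠ 0 := by exact_mod_cast h0
  have h1c : (f₁ (t z) : ℂ) ≠ 0 := by exact_mod_cast h1
  -- `N X Z` is to represent `∂_X g(Z, ·)`. The terms along `Z`, `X` and `Γ` produce the required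
  -- `G`-part. The coefficient of the `G`-null vector `ν` leaves that part unchanged and is chosen
  -- so that `τ(N X Z) = (f₂/f₁) τ(X) τ(Z) + ∂_X ∂_Z t`.
  set lam : V → V → ℂ := fun X Z => (f₂ (t z) / f₁ (t z)) * τ X * τ Z
    + dHol (fun w => dHol (fun w => (t w : ℂ)) w Z) z X - 2 * (f₁ (t z) / f (t z)) * τ X * τ Z
    - τ (Γ X Z) with hlam
  set N : V → V → V := fun X Z => ((f₁ (t z) / f (t z)) * τ X) • Z + ((f₁ (t z) / f (t z)) * τ Z) • X
    + Γ X Z + lam X Z • ν with hN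
  have hGN : ∀ X Z W, G (N X Z) W = (f₁ (t z) / f (t z)) * τ X * G Z W
      + (f₁ (t z) / f (t z)) * τ Z * G X W + G (Γ X Z) W := by
    intro X Z W
    simp only [hN, hG.add_left, hG.smul_left, hGν]
    ring
  have hτN : ∀ X Z, τ (N X Z) = (f₂ (t z) / f₁ (t z)) * τ X * τ Z
    + dHol (fun w => dHol (fun w => (t w : ℂ)) w Z) z X := by
    intro X Z
    simp only [hN, dHol_add_vec, dHol_smul_vec, hν, hlam]
    ring
  have hN1 : ∀ X Z Q, ddbar (fun w' => φ (t w')) z (N X Z) Q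
      = dHol (fun w => ddbar (fun w' => φ (t w')) w Z Q) z X := by
    intro X Z Q
    rw [hgf, hGN, hτN, dHol_ddbar_comp htd hφ hf hf₁.self_of_nhds, hΓ, dBar_ofReal]
    field_simp
    ring
  have hN2 : ∀ P, ddbar (fun w' => φ (t w')) z P (N Y W)
      = dBar (fun w => ddbar (fun w' => φ (t w')) w P W) z Y := by
    intro P
    rw [dBar_eq_conj_dHol_of_isHermForm hgn, ← hN1, hpos.conj_symm]
  have hΓ2 : ∀ P Y W, dBar (fun w => ddbar t w P W) z Y = G P (Γ Y W) := by
    intro P Y W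
    rw [dBar_eq_conj_dHol_of_isHermForm hGn, ← hΓ, hG.conj_symm]
  have hGN2 : ∀ Y W P, G P (N Y W) = (f₁ (t z) / f (t z)) * conj (τ Y) * G P W
      + (f₁ (t z) / f (t z)) * conj (τ W) * G P Y + G P (Γ Y W) := by
    intro Y W P
    rw [← hG.conj_symm, hGN, ← hG.conj_symm W, ← hG.conj_symm Y, ← hG.conj_symm (Γ Y W)]
    simp [Complex.conj_ofReal]
  have hSb : dBar (fun w => dBar (fun w => (t w : ℂ)) w W) z Y
      = conj (dHol (fun w => dHol (fun w => (t w : ℂ)) w W) z Y) := by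
    rw [← dBar_conj]
    congr 1
    funext w
    rw [dBar_ofReal]
  -- In `g(N, N)`, the `G`-part contributes `f (f₁/f)² = f₁²/f` and the `τ`-part `f₁ (f₂/f₁)² =
  -- f₂²/f₁`; all terms with `∂_X ∂_Z t` or its conjugate cancel.
  rw [hpos.curvatureTensor_eq (hN1 X Z) hN2, dHol_dBar_ddbar_comp htd hφ hf hf₁ hf₂, hgf, hGN, hτN,
    hτN, hGN2, hGN2, hGN2, hΓ2, hΓ2, ← hΓ, ← hΓ, dBar_ofReal, dBar_ofReal, hSb]
  simp only [map_add, map_mul, map_div₀, Complex.conj_ofReal]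
  push_cast
  field_simp
  ring

/-- Bookkeeping: every `G`-value costs `1/|F|` and every `τ`-value `1/s = F₁^{-1/2}`. The term `A`
involves four base lengths, which cost `1/|F|²`. -/
theorem norm_curvature_terms_le {A gXY gZW gZY gXW tX tY tZ tW : ℂ}
    {F F₁ c₂ c₃ K s x y u v : ℝ} (h0 : F ≠ 0) (h1 : 0 < F₁) (hs0 : 0 < s) (hss : s ^ 2 = F₁)
    (hx : 0 ≤ x) (hy : 0 ≤ y) (hu : 0 ≤ u) (hv : 0 ≤ v)
    (hA : ‖A‖ ≤ K * (x * y * u * v) / |F| ^ 2)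
    (hXY : ‖gXY‖ ≤ x * y / |F|) (hZW : ‖gZW‖ ≤ u * v / |F|) (hZY : ‖gZY‖ ≤ u * y / |F|)
    (hXW : ‖gXW‖ ≤ x * v / |F|) (hX : ‖tX‖ ≤ x / s) (hY : ‖tY‖ ≤ y / s) (hZ : ‖tZ‖ ≤ u / s)
    (hW : ‖tW‖ ≤ v / s) :
    ‖(F : ℂ) * A - F₁ * (gXY * gZW + gZY * gXW)
      - (c₂ : ℂ) * (tX * conj tY * gZW + gXY * tZ * conj tW + gXW * conj tY * tZ
        + tX * gZY * conj tW) - (c₃ : ℂ) * (tX * conj tY * tZ * conj tW)‖ ≤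
      (K / |F| + 2 * (F₁ / F ^ 2) + 4 * (|c₂| / (|F| * F₁)) + |c₃| / F₁ ^ 2) * (x * y * u * v) := by
  have hf0 : 0 < |F| := abs_pos.2 h0
  have T1 : ‖(F : ℂ) * A‖ ≤ K / |F| * (x * y * u * v) := by
    rw [norm_mul, Complex.norm_real, Real.norm_eq_abs]
    refine (mul_le_mul_of_nonneg_left hA hf0.le).trans (le_of_eq ?_)
    field_simp
  have T2 : ‖(F₁ : ℂ) * (gXY * gZW + gZY * gXW)‖ ≤ 2 * (F₁ / F ^ 2) * (x * y * u * v) := by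
    rw [norm_mul, Complex.norm_real, Real.norm_eq_abs, abs_of_pos h1]
    have h : ‖gXY * gZW + gZY * gXW‖ ≤ x * y / |F| * (u * v / |F|) + u * y / |F| * (x * v / |F|) := by
      refine (norm_add_le _ _).trans ?_
      rw [norm_mul, norm_mul]
      gcongr
    refine (mul_le_mul_of_nonneg_left h h1.le).trans (le_of_eq ?_)
    rw [← sq_abs F]
    field_simp
    ring
  have T3 : ‖(c₂ : ℂ) * (tX * conj tY * gZW + gXY * tZ * conj tW + gXW * conj tY * tZ
        + tX * gZY * conj tW)‖ ≤ 4 * (|c₂| / (|F| * F₁)) * (x * y * u * v) := by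
    rw [norm_mul, Complex.norm_real, Real.norm_eq_abs]
    have h : ‖tX * conj tY * gZW + gXY * tZ * conj tW + gXW * conj tY * tZ + tX * gZY * conj tW‖ ≤
        x / s * (y / s) * (u * v / |F|) + x * y / |F| * (u / s) * (v / s)
          + x * v / |F| * (y / s) * (u / s) + x / s * (u * y / |F|) * (v / s) := by
      refine (norm_add_le _ _).trans (add_le_add ((norm_add_le _ _).trans (add_le_add
        ((norm_add_le _ _).trans (add_le_add ?_ ?_)) ?_)) ?_) <;> rw [norm_mul, norm_mul] <;>
      simp only [RCLike.norm_conj] <;> gcongr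
    refine (mul_le_mul_of_nonneg_left h (abs_nonneg _)).trans (le_of_eq ?_)
    rw [← hss]
    field_simp
    ring
  have T4 : ‖(c₃ : ℂ) * (tX * conj tY * tZ * conj tW)‖ ≤ |c₃| / F₁ ^ 2 * (x * y * u * v) := by
    rw [norm_mul, Complex.norm_real, Real.norm_eq_abs, norm_mul, norm_mul, norm_mul]
    simp only [RCLike.norm_conj]
    have h : ‖tX‖ * ‖tY‖ * ‖tZ‖ * ‖tW‖ ≤ x / s * (y / s) * (u / s) * (v / s) := by gcongr
    refine (mul_le_mul_of_nonneg_left h (abs_nonneg _)).trans (le_of_eq ?_)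
    rw [← hss]
    field_simp
  calc _ ≤ _ := (norm_sub_le _ _).trans (add_le_add ((norm_sub_le _ _).trans (add_le_add
        ((norm_sub_le _ _).trans (add_le_add T1 T2)) T3)) T4)
    _ = _ := by ring

/-- The squared length of `X` is `f G(X, X) + f₁ |τ(X)|²` with both summands nonnegative, so each is
at most `|X|²`; the explicit curvature is then estimated term by term. Absolute values surround
`G(X, X)` because `G` is negative on the base when `f < 0`. -/
theorem calabi_curvatureLE (htd : ∀ᶠ w in nhds z, ContDiffAt ℝ ∞ t w)
    (hφ : ∀ᶠ s in nhds (t z), HasDerivAt φ (f s) s)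
    (hf : ∀ᶠ s in nhds (t z), HasDerivAt f (f₁ s) s)
    (hf₁ : ∀ᶠ s in nhds (t z), HasDerivAt f₁ (f₂ s) s)
    (hf₂ : HasDerivAt f₂ f₃ (t z))
    {ν : V} (hν : τ ν = 1) (hGν : ∀ W, G ν W = 0) {Γ : V → V → V}
    (hΓ : ∀ X Z W, G (Γ X Z) W = dHol (fun w => ddbar t w Z W) z X)
    (h0 : f (t z) ≠ 0) (h1 : 0 < f₁ (t z))
    (hGpos : ∀ X, 0 ≤ f (t z) * (G X X).re)
    (hGker : ∀ X, (G X X).re = 0 → τ X = 0 → X = 0) {K : ℝ}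
    (hK : ∀ X Y Z W, ‖- dHol (fun w => dBar (fun w => ddbar t w Z W) w Y) z X + G (Γ X Z) (Γ Y W)‖
      ≤ K * (Real.sqrt |(G X X).re| * Real.sqrt |(G Y Y).re| * Real.sqrt |(G Z Z).re| *
        Real.sqrt |(G W W).re|)) (hK0 : 0 ≤ K) :
    CurvatureLE (ddbar (fun w => φ (t w))) z
      (K / |f (t z)| + 2 * (f₁ (t z) / f (t z) ^ 2)
        + 4 * (|f₂ (t z) - f₁ (t z) ^ 2 / f (t z)| / (|f (t z)| * f₁ (t z)))
        + |f₃ - f₂ (t z) ^ 2 / f₁ (t z)| / f₁ (t z) ^ 2) := by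
  have ht := htd.self_of_nhds
  have hG := isHermForm_ddbar ht
  have hf0 : 0 < |f (t z)| := abs_pos.2 h0
  have hgf : ∀ X, (ddbar (fun w' => φ (t w')) z X X).re
      = f (t z) * (G X X).re + f₁ (t z) * ‖τ X‖ ^ 2 := by
    intro X
    rw [ddbar_comp htd hφ hf.self_of_nhds, dBar_ofReal]
    have : conj (τ X) * (f₁ (t z) * τ X) = ((f₁ (t z) * ‖τ X‖ ^ 2 : ℝ) : ℂ) := by
      push_cast
      rw [← Complex.conj_mul']
      ring
    rw [this, Complex.add_re, Complex.ofReal_re, Complex.re_ofReal_mul]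
  have hpos : IsPosHermForm (ddbar (fun w => φ (t w)) z) := by
    refine ⟨isHermForm_ddbar_comp htd hφ hf.self_of_nhds, fun X hX => ?_⟩
    rw [hgf]
    have a1 := hGpos X
    have a2 : 0 ≤ f₁ (t z) * ‖τ X‖ ^ 2 := by positivity
    rcases eq_or_lt_of_le (add_nonneg a1 a2) with h | h
    · exfalso
      apply hX
      have e1 : f (t z) * (G X X).re = 0 := by linarith
      have e2 : f₁ (t z) * ‖τ X‖ ^ 2 = 0 := by linarith
      exact hGker X (by simpa [h0] using e1) (by simpa [h1.ne'] using e2)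
    · exact h
  set ℓ := len (ddbar (fun w => φ (t w))) z with hℓ
  have hℓ0 : ∀ X, 0 ≤ ℓ X := fun X => Real.sqrt_nonneg _
  have hℓsq : ∀ X, ℓ X ^ 2 = f (t z) * (G X X).re + f₁ (t z) * ‖τ X‖ ^ 2 := by
    intro X
    rw [hℓ, len, Real.sq_sqrt (hpos.nonneg X), hgf]
  set s := Real.sqrt (f₁ (t z)) with hs
  have hs0 : 0 < s := Real.sqrt_pos.2 h1
  have hss : s ^ 2 = f₁ (t z) := Real.sq_sqrt h1.le
  have bτ : ∀ X, ‖τ X‖ ≤ ℓ X / s := by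
    intro X
    rw [le_div_iff₀ hs0]
    apply le_of_sq_le_sq _ (hℓ0 X)
    rw [mul_pow, hss, hℓsq]
    nlinarith [hGpos X]
  set r := Real.sqrt |f (t z)| with hr
  have hr0 : 0 < r := Real.sqrt_pos.2 hf0
  have hrr : r ^ 2 = |f (t z)| := Real.sq_sqrt hf0.le
  have bG1 : ∀ X, Real.sqrt |(G X X).re| ≤ ℓ X / r := by
    intro X
    rw [le_div_iff₀ hr0]
    apply le_of_sq_le_sq _ (hℓ0 X)
    rw [mul_pow, hrr, Real.sq_sqrt (abs_nonneg _), hℓsq, ← abs_mul, mul_comm, abs_of_nonneg (hGpos X)]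
    have : 0 ≤ f₁ (t z) * ‖τ X‖ ^ 2 := by positivity
    linarith
  -- Cauchy–Schwarz is applied to `f G`, which is semidefinite of the right sign whatever the sign
  -- of `f`.
  have hfG : IsHermForm (fun X Y => (f (t z) : ℂ) * G X Y) := by
    refine ⟨fun X X' Y => by rw [hG.add_left]; ring, fun c X Y => by rw [hG.smul_left]; ring,
      fun X Y => by rw [map_mul, Complex.conj_ofReal, hG.conj_symm]⟩
  have bG : ∀ X Y, ‖G X Y‖ ≤ ℓ X * ℓ Y / |f (t z)| := by
    intro X Y
    rw [le_div_iff₀ hf0]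
    have h := hfG.norm_le (fun X => by rw [Complex.re_ofReal_mul]; exact hGpos X) X Y
    rw [norm_mul, Complex.norm_real, Real.norm_eq_abs, Complex.re_ofReal_mul,
      Complex.re_ofReal_mul] at h
    have q : ∀ X, Real.sqrt (f (t z) * (G X X).re) ≤ ℓ X := by
      intro X
      apply Real.sqrt_le_iff.2 ⟨hℓ0 X, ?_⟩
      rw [hℓsq]
      have : 0 ≤ f₁ (t z) * ‖τ X‖ ^ 2 := by positivity
      linarith
    calc ‖G X Y‖ * |f (t z)| = |f (t z)| * ‖G X Y‖ := mul_comm _ _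
      _ ≤ _ := h
      _ ≤ _ := mul_le_mul (q X) (q Y) (Real.sqrt_nonneg _) (hℓ0 X)
  intro X Y Z W
  rw [curvatureTensor_ddbar_comp htd hφ hf hf₁ hf₂ hpos hν hGν hΓ h0 h1.ne']
  refine norm_curvature_terms_le h0 h1 hs0 hss (hℓ0 X) (hℓ0 Y) (hℓ0 Z) (hℓ0 W) ?_ (bG _ _) (bG _ _)
    (bG _ _) (bG _ _) (bτ _) (bτ _) (bτ _) (bτ _)
  refine (hK X Y Z W).trans ?_
  calc _ ≤ K * (ℓ X / r * (ℓ Y / r) * (ℓ Z / r) * (ℓ W / r)) := by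
        have := hℓ0 X
        have := hℓ0 Y
        have := hℓ0 Z
        gcongr <;> exact bG1 _
    _ = K * (ℓ X * ℓ Y * ℓ Z * ℓ W) / |f (t z)| ^ 2 := by
        rw [← hrr]; field_simp

end CalabiCurvature

/-! ### The potentials and their differential equations -/

section Profiles

open MeasureTheory Set Filter

theorem continuous_negIntegrand (n : ℕ) :
    Continuous fun u : ℝ => 1 / (1 + Real.exp u) ^ (1 / ((n : ℝ) + 1)) := by
  have h : ∀ u : ℝ, 0 < 1 + Real.exp u := fun u => by positivity
  refine continuous_const.div (Continuous.rpow_const (by fun_prop) fun u => Or.inl (h u).ne') ?_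
  intro u
  exact (Real.rpow_pos_of_pos (h u) _).ne'

theorem negIntegrand_pos (n : ℕ) (u : ℝ) : 0 < 1 / (1 + Real.exp u) ^ (1 / ((n : ℝ) + 1)) := by
  positivity

/-- From `1 + e^u ≥ e^u`. The exponential majorant gives integrability at `+∞` and shows that `F₋`
tends to `0` there. -/
theorem negIntegrand_le (n : ℕ) (u : ℝ) :
    1 / (1 + Real.exp u) ^ (1 / ((n : ℝ) + 1)) ≤ Real.exp (-(1 / ((n : ℝ) + 1)) * u) := by
  have h : Real.exp (-(1 / ((n : ℝ) + 1)) * u) = 1 / Real.exp u ^ (1 / ((n : ℝ) + 1)) := by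
    rw [← Real.exp_mul, one_div (Real.exp _), ← Real.exp_neg]
    congr 1; ring
  rw [h]
  apply one_div_le_one_div_of_le (by positivity)
  apply Real.rpow_le_rpow (by positivity) (by linarith [Real.exp_pos u]) (by positivity)

theorem integrableOn_negIntegrand (n : ℕ) (x : ℝ) :
    IntegrableOn (fun u : ℝ => 1 / (1 + Real.exp u) ^ (1 / ((n : ℝ) + 1))) (Ioi x) := by
  have ha : (0 : ℝ) < 1 / ((n : ℝ) + 1) := by positivity
  refine Integrable.mono' (exp_neg_integrableOn_Ioi x ha)
    (continuous_negIntegrand n).aestronglyMeasurable ?_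
  refine ae_of_all _ fun u => ?_
  rw [Real.norm_of_nonneg (negIntegrand_pos n u).le]
  exact negIntegrand_le n u

/-- Moves the variable endpoint into an interval integral, where the fundamental theorem of calculus
applies. -/
theorem FNeg_eq (n : ℕ) (x : ℝ) :
    FNeg n x = FNeg n 0 + ∫ u in (0 : ℝ)..x, 1 / (1 + Real.exp u) ^ (1 / ((n : ℝ) + 1)) := by
  have h := intervalIntegral.integral_interval_add_Ioi (integrableOn_negIntegrand n 0)
    (integrableOn_negIntegrand n x)
  rw [FNeg, FNeg, ← h]
  ring

theorem hasStrictDerivAt_FNeg (n : ℕ) (x : ℝ) :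
    HasStrictDerivAt (FNeg n) (1 / (1 + Real.exp x) ^ (1 / ((n : ℝ) + 1))) x := by
  have h := intervalIntegral.integral_hasStrictDerivAt_right
    ((continuous_negIntegrand n).intervalIntegrable 0 x)
    ((continuous_negIntegrand n).stronglyMeasurableAtFilter _ _)
    (continuous_negIntegrand n).continuousAt
  have e : FNeg n = fun x => FNeg n 0
      + ∫ u in (0 : ℝ)..x, 1 / (1 + Real.exp u) ^ (1 / ((n : ℝ) + 1)) := funext (FNeg_eq n)
  rw [e]
  exact h.const_add _

theorem FNeg_strictMono (n : ℕ) : StrictMono (FNeg n) := by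
  apply strictMono_of_hasDerivAt_pos (f' := fun x => 1 / (1 + Real.exp x) ^ (1 / ((n : ℝ) + 1)))
  · exact fun x => (hasStrictDerivAt_FNeg n x).hasDerivAt
  · exact negIntegrand_pos n

/-- Intermediate values: the exponential majorant brings `F₋` above any `t < 0` far to the right,
and a linear bound brings it below `t` far to the left. -/
theorem exists_FNeg_eq (n : ℕ) {t : ℝ} (ht : t < 0) : ∃ x, FNeg n x = t := by
  have ha : (0 : ℝ) < 1 / ((n : ℝ) + 1) := by positivity
  set a := 1 / ((n : ℝ) + 1) with hadef
  have hcont : Continuous (FNeg n) :=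
    continuous_iff_continuousAt.2 fun x => (hasStrictDerivAt_FNeg n x).hasDerivAt.continuousAt
  have hlow : ∀ x, -(Real.exp (-a * x) / a) ≤ FNeg n x := by
    intro x
    have h1 := setIntegral_mono (integrableOn_negIntegrand n x) (exp_neg_integrableOn_Ioi x ha)
      (fun u => negIntegrand_le n u)
    have h2 : ∫ u in Ioi x, Real.exp (-a * u) = Real.exp (-a * x) / a := by
      rw [integral_exp_mul_Ioi (by linarith) x, neg_div, div_neg, neg_neg]
    rw [FNeg]
    linarith
  obtain ⟨x₁, hx₁⟩ : ∃ x₁, t ≤ FNeg n x₁ := by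
    have hlim : Tendsto (fun x => -(Real.exp (-a * x) / a)) atTop (nhds (-(0 / a))) := by
      apply Tendsto.neg
      apply Tendsto.div_const
      apply Real.tendsto_exp_atBot.comp
      exact tendsto_id.const_mul_atTop_of_neg (by linarith)
    have := hlim.eventually (lt_mem_nhds (by simpa using ht))
    obtain ⟨x, hx⟩ := this.exists
    exact ⟨x, hx.le.trans (hlow x)⟩
  obtain ⟨x₀, hx₀⟩ : ∃ x₀, FNeg n x₀ ≤ t := by
    have h2 : (0 : ℝ) < 1 / 2 ^ a := by positivity
    -- For `u ≤ 0` one has `1 + e^u ≤ 2`, so the slope of `F₋` is at least `2^{-a}` there.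
    have hb : ∀ x ≤ (0 : ℝ), FNeg n x ≤ FNeg n 0 + x * (1 / 2 ^ a) := by
      intro x hx
      rw [FNeg_eq n x, intervalIntegral.integral_symm]
      have := intervalIntegral.integral_mono_on hx (intervalIntegrable_const (c := 1 / (2 : ℝ) ^ a)
        (μ := volume)) ((continuous_negIntegrand n).intervalIntegrable x 0) (by
          intro u hu
          apply one_div_le_one_div_of_le (by positivity)
          apply Real.rpow_le_rpow (by positivity) _ ha.le
          have := Real.exp_le_one_iff.2 hu.2
          linarith)
      rw [intervalIntegral.integral_const, smul_eq_mul] at this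
      linarith
    refine ⟨min 0 ((t - FNeg n 0) / (1 / 2 ^ a)), (hb _ (min_le_left _ _)).trans ?_⟩
    have := mul_le_mul_of_nonneg_right (min_le_right 0 ((t - FNeg n 0) / (1 / 2 ^ a))) h2.le
    rw [div_mul_cancel₀ _ h2.ne'] at this
    linarith
  exact mem_range_of_exists_le_of_exists_ge hcont ⟨x₀, hx₀⟩ ⟨x₁, hx₁⟩

theorem hasDerivAt_phiOneNeg (n : ℕ) {t : ℝ} (ht : t < 0) :
    HasDerivAt (phiOneNeg n) ((1 + Real.exp (phiOneNeg n t)) ^ (1 / ((n : ℝ) + 1))) t := by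
  obtain ⟨x, rfl⟩ := exists_FNeg_eq n ht
  have hl : ∀ x, phiOneNeg n (FNeg n x) = x :=
    Function.leftInverse_invFun (FNeg_strictMono n).injective
  have h := (hasStrictDerivAt_FNeg n x).to_local_left_inverse (g := phiOneNeg n)
    (negIntegrand_pos n x).ne' (Eventually.of_forall hl)
  rw [hl]
  simpa using h.hasDerivAt

theorem posBase_pos {u : ℝ} (hu : 0 < u) : 0 < 1 - Real.exp (-u) := by
  have := Real.exp_lt_one_iff.2 (neg_neg_of_pos hu)
  linarith

theorem posIntegrand_pos (n : ℕ) {u : ℝ} (hu : 0 < u) :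
    0 < 1 / (1 - Real.exp (-u)) ^ (1 / ((n : ℝ) + 1)) := by
  have := posBase_pos hu
  positivity

theorem one_le_posIntegrand (n : ℕ) {u : ℝ} (hu : 0 < u) :
    1 ≤ 1 / (1 - Real.exp (-u)) ^ (1 / ((n : ℝ) + 1)) := by
  have := posBase_pos hu
  rw [le_div_iff₀ (by positivity), one_mul]
  apply Real.rpow_le_one this.le _ (by positivity)
  linarith [Real.exp_pos (-u)]

/-- The singularity at `0` is of order `u^{-a}` with `a < 1`. Explicitly, `e^{-u}(1 + u) ≤ 1` gives
`u ≤ (1 + u)(1 - e^{-u})`, so the integrand is at most `(1 + x)^a u^{-a}` on `(0, x]`. -/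
theorem intervalIntegrable_posIntegrand (n : ℕ) (hn : 1 ≤ n) {x : ℝ} (hx : 0 ≤ x) :
    IntervalIntegrable (fun u : ℝ => 1 / (1 - Real.exp (-u)) ^ (1 / ((n : ℝ) + 1))) volume 0 x := by
  have hn' : (1 : ℝ) ≤ n := by exact_mod_cast hn
  have ha : (0 : ℝ) < 1 / ((n : ℝ) + 1) := by positivity
  have ha1 : 1 / ((n : ℝ) + 1) < 1 := by
    rw [div_lt_one (by positivity)]; linarith
  set a := 1 / ((n : ℝ) + 1) with hadef
  have h1 : IntervalIntegrable (fun u : ℝ => (1 + x) ^ a * u ^ (-a)) volume 0 x :=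
    (intervalIntegral.intervalIntegrable_rpow' (by linarith)).const_mul _
  refine h1.mono_fun ?_ ?_
  · apply Measurable.aestronglyMeasurable
    fun_prop
  · rw [uIoc_of_le hx]
    filter_upwards [ae_restrict_mem measurableSet_Ioc] with u hu
    have hu0 := hu.1
    have hP := posBase_pos hu0
    rw [Real.norm_of_nonneg (by positivity), Real.norm_of_nonneg (by positivity)]
    rw [Real.rpow_neg hu0.le, ← div_eq_mul_inv, ← Real.div_rpow (by linarith) hu0.le, one_div,
      ← Real.inv_rpow hP.le]
    apply Real.rpow_le_rpow (by positivity) _ ha.le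
    rw [← one_div, div_le_div_iff₀ hP hu0, one_mul]
    have h3 : Real.exp (-u) * (1 + u) ≤ 1 := by
      have := Real.add_one_le_exp u
      calc Real.exp (-u) * (1 + u) ≤ Real.exp (-u) * Real.exp u := by
            apply mul_le_mul_of_nonneg_left _ (Real.exp_pos _).le; linarith
        _ = 1 := by rw [← Real.exp_add]; simp
    nlinarith [hu.2, Real.exp_pos (-u)]

theorem hasStrictDerivAt_FPos (n : ℕ) (hn : 1 ≤ n) {x : ℝ} (hx : 0 < x) :
    HasStrictDerivAt (FPos n) (1 / (1 - Real.exp (-x)) ^ (1 / ((n : ℝ) + 1))) x := by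
  apply intervalIntegral.integral_hasStrictDerivAt_right (intervalIntegrable_posIntegrand n hn hx.le)
  · apply Measurable.stronglyMeasurable _ |>.stronglyMeasurableAtFilter
    fun_prop
  · have hP := posBase_pos hx
    refine continuousAt_const.div (ContinuousAt.rpow_const (by fun_prop) (Or.inl hP.ne')) ?_
    exact (Real.rpow_pos_of_pos hP _).ne'

theorem continuousOn_FPos (n : ℕ) (hn : 1 ≤ n) : ContinuousOn (FPos n) (Ici 0) := by
  intro x hx
  have hx' : (0 : ℝ) ≤ x := hx
  have h := intervalIntegral.continuousOn_primitive_interval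
    (f := fun u : ℝ => 1 / (1 - Real.exp (-u)) ^ (1 / ((n : ℝ) + 1))) (a := 0) (b := x + 1)
    (μ := volume) (by
      rw [uIcc_of_le (by linarith), integrableOn_Icc_iff_integrableOn_Ioc]
      exact (intervalIntegrable_iff_integrableOn_Ioc_of_le (by linarith)).1
        (intervalIntegrable_posIntegrand n hn (by linarith)))
  rw [uIcc_of_le (by linarith)] at h
  have h2 := h x ⟨hx', by linarith⟩
  refine h2.mono_of_mem_nhdsWithin ?_
  rw [← Ici_inter_Iic]
  exact inter_mem_nhdsWithin _ (Iic_mem_nhds (by linarith))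

theorem FPos_strictMonoOn (n : ℕ) (hn : 1 ≤ n) : StrictMonoOn (FPos n) (Ici 0) := by
  apply strictMonoOn_of_deriv_pos (convex_Ici 0) (continuousOn_FPos n hn)
  intro x hx
  rw [interior_Ici] at hx
  rw [(hasStrictDerivAt_FPos n hn hx).hasDerivAt.deriv]
  exact posIntegrand_pos n hx

/-- The integrand is at least `1`, so `F₊(y) ≥ y`, and intermediate values on `[0, y]` suffice. -/
theorem exists_FPos_eq (n : ℕ) (hn : 1 ≤ n) {y : ℝ} (hy : 0 < y) : ∃ x, 0 < x ∧ FPos n x = y := by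
  have h0 : FPos n 0 = 0 := by simp [FPos]
  have h1 : y ≤ FPos n y := by
    have := intervalIntegral.integral_mono_on_of_le_Ioo hy.le (intervalIntegrable_const (c := (1 : ℝ))
        (μ := volume)) (intervalIntegrable_posIntegrand n hn hy.le)
        (fun u hu => one_le_posIntegrand n hu.1)
    rw [intervalIntegral.integral_const, smul_eq_mul] at this
    rw [FPos]
    linarith
  obtain ⟨x, hx, hxy⟩ := intermediate_value_Icc hy.le
    ((continuousOn_FPos n hn).mono Icc_subset_Ici_self) (show y ∈ Icc (FPos n 0) (FPos n y) from
      ⟨by rw [h0]; exact hy.le, h1⟩)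
  refine ⟨x, lt_of_le_of_ne hx.1 ?_, hxy⟩
  rintro rfl
  rw [h0] at hxy
  exact hy.ne hxy

/-- Derivative of an inverse function, with a sign from `t ↦ -t`. The chosen inverse is a left
inverse only on `[0, ∞)`, so the preimage must be strictly positive for this to hold on a
neighbourhood. -/
theorem phiOnePos_spec (n : ℕ) (hn : 1 ≤ n) {t : ℝ} (ht : t < 0) :
    0 < phiOnePos n t ∧
      HasDerivAt (phiOnePos n) (-(1 - Real.exp (-phiOnePos n t)) ^ (1 / ((n : ℝ) + 1))) t := by
  obtain ⟨x, hx, hxt⟩ := exists_FPos_eq n hn (neg_pos.2 ht)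
  have hl : LeftInvOn (Function.invFunOn (FPos n) (Ici 0)) (FPos n) (Ici 0) :=
    (FPos_strictMonoOn n hn).injOn.leftInvOn_invFunOn
  have e : phiOnePos n t = x := by
    rw [phiOnePos, ← hxt]
    exact hl hx.le
  rw [e]
  refine ⟨hx, ?_⟩
  have h := ((hasStrictDerivAt_FPos n hn hx).to_local_left_inverse
    (g := Function.invFunOn (FPos n) (Ici 0)) (posIntegrand_pos n hx).ne'
    (by filter_upwards [Ici_mem_nhds hx] with y hy using hl hy)).hasDerivAt
  rw [hxt] at h
  refine (h.comp t (hasDerivAt_neg t)).congr_deriv ?_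
  simp

/-- The profile `φ` of a Calabi metric in terms of `f = φ'` and an auxiliary function `q`, together
forming an autonomous system of differential equations on `(-∞, 0)`. -/
structure IsProfile (a s : ℝ) (φ f q : ℝ → ℝ) : Prop where
  deriv_phi : ∀ t < 0, HasDerivAt φ (f t) t
  deriv_f : ∀ t < 0, HasDerivAt f (a * s * f t ^ 2 * (1 - q t)) t
  deriv_q : ∀ t < 0, HasDerivAt q (-s * q t * (1 - q t) * f t) t
  f_pos : ∀ t < 0, 0 < s * f t
  one_sub_q_pos : ∀ t < 0, 0 < s * (1 - q t)
  q_pos : ∀ t < 0, 0 < q t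

/-- With `p = 1 + e^{φ₁(βt)}`, `f = β p^a` and `q = 1/p`, everything follows from `p' = (p - 1) f`.
The constant `(n+1) log β` is lost on differentiation. -/
theorem isProfile_phiNeg (n : ℕ) {β : ℝ} (hβ : 0 < β) :
    ∃ f q : ℝ → ℝ, IsProfile (1 / ((n : ℝ) + 1)) 1 (phiNeg n β) f q ∧ ∀ t, q t < 1 := by
  set a := 1 / ((n : ℝ) + 1) with ha
  set p : ℝ → ℝ := fun t => 1 + Real.exp (phiOneNeg n (β * t)) with hp
  have hp1 : ∀ t, 1 < p t := fun t => by simp [hp, Real.exp_pos]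
  have hp0 : ∀ t, 0 < p t := fun t => zero_lt_one.trans (hp1 t)
  have hφ : ∀ t < 0, HasDerivAt (fun t => phiOneNeg n (β * t)) (β * p t ^ a) t := by
    intro t ht
    have h := (hasDerivAt_phiOneNeg n (mul_neg_of_pos_of_neg hβ ht)).comp t
      ((hasDerivAt_id t).const_mul β)
    refine h.congr_deriv ?_
    simp [hp, mul_comm, ha]
  have hp' : ∀ t < 0, HasDerivAt p ((p t - 1) * (β * p t ^ a)) t := by
    intro t ht
    have h := (hφ t ht).exp.const_add 1
    refine h.congr_deriv ?_
    simp [hp]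
  refine ⟨fun t => β * p t ^ a, fun t => 1 / p t, ⟨?_, ?_, ?_, ?_, ?_, ?_⟩, ?_⟩
  · intro t ht
    exact (hφ t ht).add_const _
  · intro t ht
    have h := ((hp' t ht).rpow_const (p := a) (Or.inl (hp0 t).ne')).const_mul β
    refine h.congr_deriv ?_
    have := (hp0 t).ne'
    rw [Real.rpow_sub_one this]
    field_simp
  · intro t ht
    have h := (hp' t ht).inv (hp0 t).ne'
    simp only [one_div]
    refine h.congr_deriv ?_
    have := (hp0 t).ne'
    field_simp
  · intro t ht
    have := hp0 t
    positivity
  · intro t ht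
    rw [one_mul, sub_pos, div_lt_one (hp0 t)]
    exact hp1 t
  · intro t ht
    have := hp0 t
    positivity
  · intro t
    rw [div_lt_one (hp0 t)]
    exact hp1 t

/-- With `p = 1 - e^{-φ}`, `f = -β p^a` and `q = 1/p`, the system follows from `p' = (1 - p) f`.
Here `f < 0` and `q > 1`, which the sign `s = -1` compensates. -/
theorem isProfile_phiPos (n : ℕ) (hn : 1 ≤ n) {β : ℝ} (hβ : 0 < β) :
    (∀ t < 0, 0 < phiPos n β t) ∧
    IsProfile (1 / ((n : ℝ) + 1)) (-1) (phiPos n β)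
      (fun t => -β * (1 - Real.exp (-phiPos n β t)) ^ (1 / ((n : ℝ) + 1)))
      (fun t => 1 / (1 - Real.exp (-phiPos n β t))) := by
  set a := 1 / ((n : ℝ) + 1) with ha
  have hpos : ∀ t < 0, 0 < phiPos n β t := fun t ht =>
    (phiOnePos_spec n hn (mul_neg_of_pos_of_neg hβ ht)).1
  set p : ℝ → ℝ := fun t => 1 - Real.exp (-phiPos n β t) with hp
  have hp0 : ∀ t < 0, 0 < p t := fun t ht => posBase_pos (hpos t ht)
  have hp1 : ∀ t, p t < 1 := fun t => by simp [hp, Real.exp_pos]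
  have hφ : ∀ t < 0, HasDerivAt (phiPos n β) (-β * p t ^ a) t := by
    intro t ht
    have h := (phiOnePos_spec n hn (mul_neg_of_pos_of_neg hβ ht)).2.comp t
      ((hasDerivAt_id t).const_mul β)
    refine h.congr_deriv ?_
    simp [hp, mul_comm, ha, phiPos]
  have hp' : ∀ t < 0, HasDerivAt p ((1 - p t) * (-β * p t ^ a)) t := by
    intro t ht
    have h := (hφ t ht).neg.exp.const_sub 1
    refine h.congr_deriv ?_
    simp [hp]
  refine ⟨hpos, ⟨hφ, ?_, ?_, ?_, ?_, ?_⟩⟩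
  · intro t ht
    have h := ((hp' t ht).rpow_const (p := a) (Or.inl (hp0 t ht).ne')).const_mul (-β)
    refine h.congr_deriv ?_
    change _ = a * -1 * (-β * p t ^ a) ^ 2 * (1 - 1 / p t)
    have := (hp0 t ht).ne'
    rw [Real.rpow_sub_one this]
    field_simp
    ring
  · intro t ht
    have h := (hp' t ht).inv (hp0 t ht).ne'
    simp only [one_div]
    refine h.congr_deriv ?_
    change _ = - -1 * (p t)⁻¹ * (1 - (p t)⁻¹) * (-β * p t ^ a)
    have := (hp0 t ht).ne'
    field_simp
    ring
  · intro t ht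
    change 0 < -1 * (-β * p t ^ a)
    have := Real.rpow_pos_of_pos (hp0 t ht) a
    have := mul_pos hβ this
    linarith
  · intro t ht
    change 0 < -1 * (1 - 1 / p t)
    have : 1 < 1 / p t := by
      rw [lt_div_iff₀ (hp0 t ht)]; linarith [hp1 t]
    linarith
  · intro t ht
    exact one_div_pos.2 (hp0 t ht)

/-- Along a profile, the scalar coefficients of the curvature of the Calabi metric are bounded by
`1 + q`. -/
theorem IsProfile.exists_derivs {a s : ℝ} {φ f q : ℝ → ℝ} (h : IsProfile a s φ f q)
    (hs : s ^ 2 = 1) (ha : 0 < a) (ha' : a ≤ 1 / 2) :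
    ∃ f₁ f₂ f₃ : ℝ → ℝ, ∀ t < 0, HasDerivAt f (f₁ t) t ∧ HasDerivAt f₁ (f₂ t) t ∧
      HasDerivAt f₂ (f₃ t) t ∧ 0 < f₁ t ∧
      2 * (f₁ t / f t ^ 2) + 4 * (|f₂ t - f₁ t ^ 2 / f t| / (|f t| * f₁ t))
        + |f₃ t - f₂ t ^ 2 / f₁ t| / f₁ t ^ 2 ≤ (8 + 1 / a) * (1 + q t) := by
  -- Obtained by repeatedly substituting the system. The third function is arranged as `f₂²/f₁` plus
  -- a multiple of `f₁²`, so that the last ratio can be read off.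
  refine ⟨fun t => a * s * f t ^ 2 * (1 - q t),
    fun t => a * f t ^ 3 * (1 - q t) * (2 * a * (1 - q t) + q t),
    fun t => (a * s * f t ^ 4 * (1 - q t) * (2 * a * (1 - q t) + q t) ^ 2 + s * (a * f t ^ 2 * (1 - q t)) ^ 2 *
      ((2 * a * (1 - q t) + q t) - (1 - 2 * a) * q t / a)), fun t ht => ?_⟩
  have hf := h.deriv_f t ht
  have hq := h.deriv_q t ht
  have hf0 := h.f_pos t ht
  have hq1 := h.one_sub_q_pos t ht
  have hq0 := h.q_pos t ht
  have hfne : f t ≠ 0 := fun h => by simp [h] at hf0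
  have hqne : 1 - q t ≠ 0 := fun h => by simp [h] at hq1
  have hsne : s ≠ 0 := fun h => by simp [h] at hs
  have hane := ha.ne'
  have hsabs : |s| = 1 := by
    have : |s| ^ 2 = 1 := by rw [sq_abs, hs]
    nlinarith [abs_nonneg s]
  have h1 : 0 < a * s * f t ^ 2 * (1 - q t) := by
    have : a * s * f t ^ 2 * (1 - q t) = a * f t ^ 2 * (s * (1 - q t)) := by ring
    rw [this]; positivity
  have habs : |1 - q t| ≤ 1 + q t := by
    rw [abs_le]; constructor <;> linarith
  refine ⟨hf, ?_, ?_, h1, ?_⟩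
  · have := ((hf.pow 2).const_mul (a * s)).mul (hq.const_sub 1)
    refine this.congr_deriv ?_
    simp only [Pi.pow_apply]
    linear_combination (a * f t ^ 3 * (1 - q t) * (2 * a * (1 - q t) + q t)) * hs
  · have := (((hf.pow 3).const_mul a).mul (hq.const_sub 1)).mul
      (((hq.const_sub 1).const_mul (2 * a)).add hq)
    refine this.congr_deriv ?_
    simp only [Pi.pow_apply, Pi.mul_apply, Pi.add_apply]
    field_simp
    ring
  -- In each of the three ratios all powers of `f` cancel, leaving only `q`.
  · have e1 : a * s * f t ^ 2 * (1 - q t) / f t ^ 2 = a * (s * (1 - q t)) := by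
      field_simp
    have e1' : a * (s * (1 - q t)) ≤ 1 / 2 * (1 + q t) := by
      have hb : s * (1 - q t) ≤ 1 + q t := by
        refine (le_abs_self _).trans ?_
        rw [abs_mul, hsabs, one_mul]
        exact habs
      exact mul_le_mul ha' hb hq1.le (by norm_num)
    have e2 : |a * f t ^ 3 * (1 - q t) * (2 * a * (1 - q t) + q t) -
        (a * s * f t ^ 2 * (1 - q t)) ^ 2 / f t| / (|f t| * (a * s * f t ^ 2 * (1 - q t)))
        = |a * (1 - q t) + q t| := by
      rw [div_eq_iff (by positivity)]
      conv_rhs => rw [← abs_of_pos h1]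
      rw [← abs_mul, ← abs_mul]
      have : a * f t ^ 3 * (1 - q t) * (2 * a * (1 - q t) + q t) -
        (a * s * f t ^ 2 * (1 - q t)) ^ 2 / f t
          = s * ((a * (1 - q t) + q t) * (f t * (a * s * f t ^ 2 * (1 - q t)))) := by
        field_simp
        linear_combination (-(1 - q t) * a - (a * (1 - q t) + q t)) * hs
      rw [this, abs_mul, hsabs, one_mul]
    have e2' : |a * (1 - q t) + q t| ≤ 1 + q t := by
      rw [abs_le]; constructor <;> nlinarith
    have e3 : |(a * s * f t ^ 4 * (1 - q t) * (2 * a * (1 - q t) + q t) ^ 2 + s * (a * f t ^ 2 * (1 - q t)) ^ 2 *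
      ((2 * a * (1 - q t) + q t) - (1 - 2 * a) * q t / a)) -
        (a * f t ^ 3 * (1 - q t) * (2 * a * (1 - q t) + q t)) ^ 2 / (a * s * f t ^ 2 * (1 - q t))|
        / (a * s * f t ^ 2 * (1 - q t)) ^ 2
        = |(2 * a * (1 - q t) + q t) - (1 - 2 * a) * q t / a| := by
      rw [div_eq_iff (by positivity)]
      conv_rhs => rw [← abs_of_pos (pow_pos h1 2)]
      rw [← abs_mul]
      have : (a * s * f t ^ 4 * (1 - q t) * (2 * a * (1 - q t) + q t) ^ 2 + s * (a * f t ^ 2 * (1 - q t)) ^ 2 *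
      ((2 * a * (1 - q t) + q t) - (1 - 2 * a) * q t / a)) -
        (a * f t ^ 3 * (1 - q t) * (2 * a * (1 - q t) + q t)) ^ 2 / (a * s * f t ^ 2 * (1 - q t))
        = s * (((2 * a * (1 - q t) + q t) - (1 - 2 * a) * q t / a) *
          (a * s * f t ^ 2 * (1 - q t)) ^ 2) := by
        have e4 : (a * f t ^ 3 * (1 - q t) * (2 * a * (1 - q t) + q t)) ^ 2 /
            (a * s * f t ^ 2 * (1 - q t))
            = a * s * f t ^ 4 * (1 - q t) * (2 * a * (1 - q t) + q t) ^ 2 := by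
          rw [div_eq_iff h1.ne']
          linear_combination (-(a * f t ^ 3 * (1 - q t) * (2 * a * (1 - q t) + q t)) ^ 2) * hs
        rw [e4]
        linear_combination (-s * (a * f t ^ 2 * (1 - q t)) ^ 2 *
          ((2 * a * (1 - q t) + q t) - (1 - 2 * a) * q t / a)) * hs
      rw [this, abs_mul, hsabs, one_mul]
    have e3' : |(2 * a * (1 - q t) + q t) - (1 - 2 * a) * q t / a| ≤ (3 + 1 / a) * (1 + q t) := by
      have hqa : 0 < q t / a := by positivity
      have e : (2 * a * (1 - q t) + q t) - (1 - 2 * a) * q t / a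
          = 2 * a * (1 - q t) + 3 * q t - q t / a := by field_simp; ring
      have e' : (3 + 1 / a) * (1 + q t) = 3 + 3 * q t + 1 / a + q t / a := by field_simp; ring
      have ha0 : 0 < 1 / a := by positivity
      rw [e, e', abs_le]; constructor <;> nlinarith
    -- The constants add up to `2 · 1/2 + 4 · 1 + (3 + 1/a) = 8 + 1/a`.
    rw [e1, e2, e3]
    have : 0 < (1 / a) * (1 + q t) := by positivity
    nlinarith

end Profiles

/-! ### Smooth local metrics and holomorphic changes of coordinates -/

section LocalMetrics

open Filter Topology

variable {V : Type*} [NormedAddCommGroup V] [NormedSpace ℂ V]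

/-- The Hermitian forms `g w` are positive definite and depend smoothly on `w` near `p`. -/
def IsMetricNear (g : V → V → V → ℂ) (p : V) : Prop :=
  ∀ᶠ w in 𝓝 p, IsPosHermForm (g w) ∧ ∀ X Y, ContDiffAt ℝ ∞ (fun w' => g w' X Y) w

namespace IsMetricNear

variable {g : V → V → V → ℂ} {p : V} (hg : IsMetricNear g p)

include hg

theorem posHerm : IsPosHermForm (g p) := hg.self_of_nhds.1

theorem contDiffAt (X Y : V) : ContDiffAt ℝ ∞ (fun w => g w X Y) p := hg.self_of_nhds.2 X Y

theorem herm : ∀ᶠ w in 𝓝 p, IsHermForm (g w) := hg.mono fun _ h => h.1.toIsHermForm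

theorem eventually : ∀ᶠ w in 𝓝 p, IsMetricNear g w := hg.eventually_nhds

theorem dHol_add_left (X Z Z' W : V) : dHol (fun w => g w (Z + Z') W) p X
    = dHol (fun w => g w Z W) p X + dHol (fun w => g w Z' W) p X := by
  rw [← dHol_add (hg.contDiffAt _ _).differentiableAt_infty (hg.contDiffAt _ _).differentiableAt_infty]
  exact dHol_congr (hg.herm.mono fun w hw => hw.add_left _ _ _) X

theorem dHol_add_right (X Z W W' : V) : dHol (fun w => g w Z (W + W')) p X
    = dHol (fun w => g w Z W) p X + dHol (fun w => g w Z W') p X := by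
  rw [← dHol_add (hg.contDiffAt _ _).differentiableAt_infty (hg.contDiffAt _ _).differentiableAt_infty]
  exact dHol_congr (hg.herm.mono fun w hw => hw.add_right _ _ _) X

theorem dHol_smul_left (X : V) (c : ℂ) (Z W : V) :
    dHol (fun w => g w (c • Z) W) p X = c * dHol (fun w => g w Z W) p X := by
  rw [← dHol_const_mul]
  exact dHol_congr (hg.herm.mono fun w hw => hw.smul_left _ _ _) X

theorem dHol_smul_right (X : V) (c : ℂ) (Z W : V) :
    dHol (fun w => g w Z (c • W)) p X = conj c * dHol (fun w => g w Z W) p X := by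
  rw [← dHol_const_mul]
  exact dHol_congr (hg.herm.mono fun w hw => hw.smul_right _ _ _) X

theorem dBar_smul_left (X : V) (c : ℂ) (Z W : V) :
    dBar (fun w => g w (c • Z) W) p X = c * dBar (fun w => g w Z W) p X := by
  rw [← dBar_const_mul]
  exact dBar_congr (hg.herm.mono fun w hw => hw.smul_left _ _ _) X

theorem dBar_smul_right (X : V) (c : ℂ) (Z W : V) :
    dBar (fun w => g w Z (c • W)) p X = conj c * dBar (fun w => g w Z W) p X := by
  rw [← dBar_const_mul]
  exact dBar_congr (hg.herm.mono fun w hw => hw.smul_right _ _ _) X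

theorem dBar_eq_conj (Y P W : V) :
    dBar (fun w => g w P W) p Y = conj (dHol (fun w => g w W P) p Y) :=
  dBar_eq_conj_dHol_of_isHermForm hg.herm Y P W

end IsMetricNear

variable [FiniteDimensional ℂ V]

/-- The connection of a metric. -/
theorem IsMetricNear.exists_connection {g : V → V → V → ℂ} {p : V} (hg : IsMetricNear g p) :
    ∃ Γ : V → V → V, ∀ X Z W, g p (Γ X Z) W = dHol (fun w => g w Z W) p X := by
  have h : ∀ X Z, ∃ Γ, ∀ W, g p Γ W = dHol (fun w => g w Z W) p X := fun X Z =>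
    hg.posHerm.exists_repr _ (fun W W' => hg.dHol_add_right X Z W W')
      (fun c W => hg.dHol_smul_right X c Z W)
  choose Γ hΓ using h
  exact ⟨Γ, hΓ⟩

theorem IsMetricNear.curvatureTensor_eq {g : V → V → V → ℂ} {p : V} (hg : IsMetricNear g p)
    {Γ : V → V → V} (hΓ : ∀ X Z W, g p (Γ X Z) W = dHol (fun w => g w Z W) p X) (X Y Z W : V) :
    curvatureTensor g p X Y Z W =
      - dHol (fun w => dBar (fun w' => g w' Z W) w Y) p X + g p (Γ X Z) (Γ Y W) := by
  refine hg.posHerm.curvatureTensor_eq (hΓ X Z) fun P => ?_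
  rw [hg.dBar_eq_conj, ← hΓ, hg.posHerm.conj_symm]

theorem contDiff_repr (i : Fin (Module.finrank ℂ V)) :
    ContDiff ℝ ∞ fun X : V => (Module.finBasis ℂ V).repr X i :=
  (((Module.finBasis ℂ V).coord i).toContinuousLinearMap.restrictScalars ℝ).contDiff

theorem differentiable_repr (i : Fin (Module.finrank ℂ V)) :
    Differentiable ℂ fun X : V => (Module.finBasis ℂ V).repr X i :=
  ((Module.finBasis ℂ V).coord i).toContinuousLinearMap.differentiable

theorem IsHermForm.eq_sum {g : V → V → ℂ} (hg : IsHermForm g) (A B : V) :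
    g A B = ∑ i, ∑ j, (Module.finBasis ℂ V).repr A i * (conj ((Module.finBasis ℂ V).repr B j) *
      g (Module.finBasis ℂ V i) (Module.finBasis ℂ V j)) := by
  conv_lhs => rw [← (Module.finBasis ℂ V).sum_repr A, ← (Module.finBasis ℂ V).sum_repr B]
  rw [hg.sum_left]
  simp only [hg.sum_right, Finset.mul_sum]

theorem differentiable_bilin {f : V → V → ℂ} (h1 : ∀ A A' B, f (A + A') B = f A B + f A' B)
    (h2 : ∀ (c : ℂ) A B, f (c • A) B = c * f A B) (h3 : ∀ A B B', f A (B + B') = f A B + f A B')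
    (h4 : ∀ (c : ℂ) A B, f A (c • B) = c * f A B) : Differentiable ℂ fun q : V × V => f q.1 q.2 := by
  have e : (fun q : V × V => f q.1 q.2) = fun q : V × V => ∑ i, ∑ j,
      (Module.finBasis ℂ V).repr q.1 i * ((Module.finBasis ℂ V).repr q.2 j *
        f (Module.finBasis ℂ V i) (Module.finBasis ℂ V j)) := by
    funext q
    have := LinearMap.sum_repr_mul_repr_mul (B := LinearMap.mk₂ ℂ f h1 h2 h3 h4)
      (Module.finBasis ℂ V) (Module.finBasis ℂ V) q.1 q.2
    rw [LinearMap.mk₂_apply] at this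
    rw [← this, Finsupp.sum_fintype _ _ (by simp)]
    refine Finset.sum_congr rfl fun i _ => ?_
    rw [Finsupp.sum_fintype _ _ (by simp)]
    simp
  rw [e]
  have d1 : ∀ i, Differentiable ℂ fun q : V × V => (Module.finBasis ℂ V).repr q.1 i := fun i =>
    (differentiable_repr i).comp differentiable_fst
  have d2 : ∀ i, Differentiable ℂ fun q : V × V => (Module.finBasis ℂ V).repr q.2 i := fun i =>
    (differentiable_repr i).comp differentiable_snd
  refine Differentiable.fun_sum fun i _ => Differentiable.fun_sum fun j _ => ?_
  exact (d1 i).mul ((d2 j).mul_const _)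

theorem differentiable_lin {f : V → ℂ} (h1 : ∀ A A', f (A + A') = f A + f A')
    (h2 : ∀ (c : ℂ) A, f (c • A) = c * f A) : Differentiable ℂ f :=
  (LinearMap.toContinuousLinearMap (⟨⟨f, h1⟩, h2⟩ : V →ₗ[ℂ] ℂ)).differentiable

theorem dHol_lin {f : V → ℂ} (h1 : ∀ A A', f (A + A') = f A + f A')
    (h2 : ∀ (c : ℂ) A, f (c • A) = c * f A) (A X : V) : dHol f A X = f X :=
  dHol_holomorphic (c' := LinearMap.toContinuousLinearMap (⟨⟨f, h1⟩, h2⟩ : V →ₗ[ℂ] ℂ))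
    (ContinuousLinearMap.hasFDerivAt _) X

/-- The function `(w, A, B) ↦ g_w(A, B)`. -/
def jointForm (g : V → V → V → ℂ) (q : V × V × V) : ℂ := g q.1 q.2.1 q.2.2

/-- Smoothness for fixed vectors becomes joint smoothness by expanding in a finite basis, since the
coordinates are linear and their conjugates real smooth. -/
theorem IsMetricNear.contDiffAt_jointForm {g : V → V → V → ℂ} {p : V} (hg : IsMetricNear g p)
    (A B : V) : ContDiffAt ℝ ∞ (jointForm g) (p, A, B) := by
  have e : jointForm g =ᶠ[𝓝 (p, A, B)] fun q => ∑ i, ∑ j, (Module.finBasis ℂ V).repr q.2.1 i *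
      (conj ((Module.finBasis ℂ V).repr q.2.2 j) *
        g q.1 (Module.finBasis ℂ V i) (Module.finBasis ℂ V j)) := by
    filter_upwards [(continuousAt_fst (p := (p, A, B))).eventually hg.herm] with q hq
    exact hq.eq_sum q.2.1 q.2.2
  refine ContDiffAt.congr_of_eventuallyEq ?_ e
  refine ContDiffAt.sum fun i _ => ContDiffAt.sum fun j _ => ?_
  refine ContDiffAt.mul ?_ (ContDiffAt.mul ?_ ?_)
  · exact ((contDiff_repr i).comp (contDiff_fst.comp contDiff_snd)).contDiffAt
  · exact (Complex.conjCLE.contDiff.comp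
      ((contDiff_repr j).comp (contDiff_snd.comp contDiff_snd))).contDiffAt
  · exact ContDiffAt.comp (p, A, B) (hg.contDiffAt _ _) contDiffAt_fst

/-- The derivative of `Ψ(ρ(w), A(w), C(w))`, where `Ψ` is linear in the second and antiholomorphic
in the third variable. -/
theorem dHol_joint {F : Type*} [NormedAddCommGroup F] [NormedSpace ℂ F] {U : Type*}
    [NormedAddCommGroup U] [NormedSpace ℂ U]
    {Ψ : V × V × F → ℂ} {ρ A : U → V} {C : U → F} {z : U} {ρ' A' : U →L[ℂ] V} {C' : U →L[ℂ] F}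
    (hρ : HasFDerivAt ρ ρ' z) (hA : HasFDerivAt A A' z) (hC : HasFDerivAt C C' z)
    (hΨ : DifferentiableAt ℝ Ψ (ρ z, A z, C z))
    (h1 : ∀ B B', Ψ (ρ z, B + B', C z) = Ψ (ρ z, B, C z) + Ψ (ρ z, B', C z))
    (h2 : ∀ (c : ℂ) B, Ψ (ρ z, c • B, C z) = c * Ψ (ρ z, B, C z))
    (h3 : ∀ Q, dHol (fun y => Ψ (ρ z, A z, y)) (C z) Q = 0) (X : U) :
    dHol (fun w => Ψ (ρ w, A w, C w)) z X =
      dHol (fun y => Ψ (y, A z, C z)) (ρ z) (ρ' X) + Ψ (ρ z, A' X, C z) := by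
  rw [dHol_comp (F := Ψ) (c := fun w => (ρ w, A w, C w)) hΨ (hρ.prodMk (hA.prodMk hC))]
  -- Splits the direction into its three slots: the first gives the base derivative, linearity
  -- evaluates the second, and antiholomorphy kills the third.
  have e : (ρ'.prod (A'.prod C')) X = (ρ' X, 0, 0) + ((0, A' X, 0) + (0, 0, C' X)) := by simp
  rw [e, dHol_add_vec, dHol_add_vec]
  have c1 : HasFDerivAt (fun y : V => (y, A z, C z))
      ((ContinuousLinearMap.id ℂ V).prod (0 : V →L[ℂ] V × F)) (ρ z) :=
    (hasFDerivAt_id (𝕜 := ℂ) (ρ z)).prodMk (hasFDerivAt_const _ _)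
  have c2 : HasFDerivAt (fun y : V => (ρ z, y, C z))
      ((0 : V →L[ℂ] V).prod ((ContinuousLinearMap.id ℂ V).prod (0 : V →L[ℂ] F))) (A z) :=
    (hasFDerivAt_const _ _).prodMk ((hasFDerivAt_id (𝕜 := ℂ) (A z)).prodMk (hasFDerivAt_const _ _))
  have c3 : HasFDerivAt (fun y : F => (ρ z, A z, y))
      ((0 : F →L[ℂ] V).prod ((0 : F →L[ℂ] V).prod (ContinuousLinearMap.id ℂ F))) (C z) :=
    (hasFDerivAt_const _ _).prodMk ((hasFDerivAt_const _ _).prodMk (hasFDerivAt_id (𝕜 := ℂ) (C z)))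
  have d1 := dHol_comp (F := Ψ) (c := fun y : V => (y, A z, C z)) hΨ c1 (ρ' X)
  have d2 := dHol_comp (F := Ψ) (c := fun y : V => (ρ z, y, C z)) hΨ c2 (A' X)
  have d3 := dHol_comp (F := Ψ) (c := fun y : F => (ρ z, A z, y)) hΨ c3 (C' X)
  rw [h3] at d3
  rw [dHol_lin h1 h2] at d2
  simp only [ContinuousLinearMap.prod_apply, ContinuousLinearMap.id_apply, zero_apply] at d1 d2 d3
  rw [d1, d2, ← d3, add_zero]
  rfl

theorem dHol_antilin {f : V → ℂ} (h1 : ∀ A A', f (A + A') = f A + f A')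
    (h2 : ∀ (c : ℂ) A, f (c • A) = conj c * f A) (A X : V) : dHol f A X = 0 := by
  have h := (differentiable_lin (f := fun A => conj (f A)) (fun A A' => by simp [h1])
    (fun c A => by simp [h2]) A).hasFDerivAt
  have := dBar_holomorphic h X
  rw [dBar_conj] at this
  simpa using this

theorem dHol_jointForm {g : V → V → V → ℂ} {U : Type*} [NormedAddCommGroup U] [NormedSpace ℂ U]
    {ρ A B : U → V} {z : U} {ρ' A' B' : U →L[ℂ] V} (hg : IsMetricNear g (ρ z))
    (hρ : HasFDerivAt ρ ρ' z) (hA : HasFDerivAt A A' z) (hB : HasFDerivAt B B' z) (X : U) :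
    dHol (fun w => g (ρ w) (A w) (B w)) z X =
      dHol (fun y => g y (A z) (B z)) (ρ z) (ρ' X) + g (ρ z) (A' X) (B z) :=
  dHol_joint (Ψ := jointForm g) hρ hA hB (hg.contDiffAt_jointForm _ _).differentiableAt_infty
    (fun _ _ => hg.posHerm.add_left _ _ _) (fun _ _ => hg.posHerm.smul_left _ _ _)
    (dHol_antilin (fun _ _ => hg.posHerm.add_right _ _ _) (fun _ _ => hg.posHerm.smul_right _ _ _) _)
    X

theorem dBar_jointForm {g : V → V → V → ℂ} {U : Type*} [NormedAddCommGroup U] [NormedSpace ℂ U]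
    {ρ A B : U → V} {z : U} {ρ' A' B' : U →L[ℂ] V} (hg : IsMetricNear g (ρ z))
    (hρ : HasFDerivAt ρ ρ' z) (hA : HasFDerivAt A A' z) (hB : HasFDerivAt B B' z) (Y : U) :
    dBar (fun w => g (ρ w) (A w) (B w)) z Y =
      dBar (fun y => g y (A z) (B z)) (ρ z) (ρ' Y) + g (ρ z) (A z) (B' Y) := by
  have e : (fun w => g (ρ w) (A w) (B w)) =ᶠ[𝓝 z] fun w => conj (g (ρ w) (B w) (A w)) := by
    filter_upwards [hρ.continuousAt.eventually hg.herm] with w hw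
    exact (hw.conj_symm _ _).symm
  rw [dBar_congr e, dBar_conj, dHol_jointForm hg hρ hB hA, map_add, hg.posHerm.conj_symm,
    hg.dBar_eq_conj]

/-- The function `(w, A, B, Q) ↦ ∂̄_Q (g(A, B))(w)`. -/
def jointDBar (g : V → V → V → ℂ) (q : V × V × V × V) : ℂ :=
  dBar (fun w => g w q.2.1 q.2.2.1) q.1 q.2.2.2

theorem IsMetricNear.dHol_jointForm_fst {g : V → V → V → ℂ} {p : V} (hg : IsMetricNear g p)
    (A B P : V) : dHol (jointForm g) (p, A, B) (P, 0, 0) = dHol (fun w => g w A B) p P := by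
  have c1 : HasFDerivAt (fun y : V => (y, A, B))
      ((ContinuousLinearMap.id ℂ V).prod (0 : V →L[ℂ] V × V)) p :=
    (hasFDerivAt_id (𝕜 := ℂ) p).prodMk (hasFDerivAt_const _ _)
  exact (dHol_comp (F := jointForm g) (c := fun y : V => (y, A, B))
    (hg.contDiffAt_jointForm A B).differentiableAt_infty c1 P).symm

theorem IsMetricNear.dBar_jointForm_fst {g : V → V → V → ℂ} {p : V} (hg : IsMetricNear g p)
    (A B P : V) : dBar (jointForm g) (p, A, B) (P, 0, 0) = dBar (fun w => g w A B) p P := by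
  have c1 : HasFDerivAt (fun y : V => (y, A, B))
      ((ContinuousLinearMap.id ℂ V).prod (0 : V →L[ℂ] V × V)) p :=
    (hasFDerivAt_id (𝕜 := ℂ) p).prodMk (hasFDerivAt_const _ _)
  exact (dBar_comp (F := jointForm g) (c := fun y : V => (y, A, B))
    (hg.contDiffAt_jointForm A B).differentiableAt_infty c1 P).symm

theorem contDiffAt_dBar_joint {U W : Type*} [NormedAddCommGroup U] [NormedSpace ℂ U]
    [NormedAddCommGroup W] [NormedSpace ℝ W] {f : U → ℂ} {c X : W → U} {q : W}
    (hf : ContDiffAt ℝ ∞ f (c q)) (hc : ContDiffAt ℝ ∞ c q) (hX : ContDiffAt ℝ ∞ X q) :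
    ContDiffAt ℝ ∞ (fun y => dBar f (c y) (X y)) q := by
  have h := (hf.fderiv_right (m := ∞) (by simp)).comp q hc
  have h2 : ContDiffAt ℝ ∞ (fun y => fderiv ℝ f (c y)) q := h
  unfold dBar
  exact contDiffAt_const.mul ((h2.clm_apply hX).add
    (contDiffAt_const.mul (h2.clm_apply (hX.const_smul Complex.I))))

theorem contDiffAt_dHol_joint {U W : Type*} [NormedAddCommGroup U] [NormedSpace ℂ U]
    [NormedAddCommGroup W] [NormedSpace ℝ W] {f : U → ℂ} {c X : W → U} {q : W}
    (hf : ContDiffAt ℝ ∞ f (c q)) (hc : ContDiffAt ℝ ∞ c q) (hX : ContDiffAt ℝ ∞ X q) :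
    ContDiffAt ℝ ∞ (fun y => dHol f (c y) (X y)) q := by
  have h := (hf.fderiv_right (m := ∞) (by simp)).comp q hc
  have h2 : ContDiffAt ℝ ∞ (fun y => fderiv ℝ f (c y)) q := h
  unfold dHol
  exact contDiffAt_const.mul ((h2.clm_apply hX).sub
    (contDiffAt_const.mul (h2.clm_apply (hX.const_smul Complex.I))))

/-- Near the point, `jointDBar g` is the `∂̄`-derivative of the smooth function `jointForm g` in a
base direction. -/
theorem IsMetricNear.contDiffAt_jointDBar {g : V → V → V → ℂ} {p : V} (hg : IsMetricNear g p)
    (A B Q : V) : ContDiffAt ℝ ∞ (jointDBar g) (p, A, B, Q) := by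
  have e : jointDBar g =ᶠ[𝓝 (p, A, B, Q)] fun q =>
      dBar (jointForm g) (q.1, q.2.1, q.2.2.1) (q.2.2.2, 0, 0) := by
    filter_upwards [(continuousAt_fst (p := (p, A, B, Q))).eventually hg.eventually] with q hq
    exact (hq.dBar_jointForm_fst _ _ _).symm
  refine ContDiffAt.congr_of_eventuallyEq ?_ e
  exact contDiffAt_dBar_joint (f := jointForm g)
    (c := fun q : V × V × V × V => (q.1, q.2.1, q.2.2.1))
    (X := fun q : V × V × V × V => (q.2.2.2, 0, 0)) (hg.contDiffAt_jointForm _ _)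
    (by fun_prop) (by fun_prop)

/-- The vectors `B` and `Q` enter conjugate linearly, so for holomorphic `B(w)` and `Q(w)` their
derivatives do not contribute to `∂`. -/
theorem dHol_jointDBar {g : V → V → V → ℂ} {U : Type*} [NormedAddCommGroup U] [NormedSpace ℂ U]
    {ρ A B Q : U → V} {z : U} {ρ' A' B' Q' : U →L[ℂ] V} (hg : IsMetricNear g (ρ z))
    (hρ : HasFDerivAt ρ ρ' z) (hA : HasFDerivAt A A' z) (hB : HasFDerivAt B B' z)
    (hQ : HasFDerivAt Q Q' z) (X : U) :
    dHol (fun w => dBar (fun y => g y (A w) (B w)) (ρ w) (Q w)) z X =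
      dHol (fun w => dBar (fun y => g y (A z) (B z)) w (Q z)) (ρ z) (ρ' X)
        + dBar (fun y => g y (A' X) (B z)) (ρ z) (Q z) := by
  refine dHol_joint (Ψ := jointDBar g) (C := fun w => (B w, Q w)) hρ hA (hB.prodMk hQ)
    (hg.contDiffAt_jointDBar _ _ _).differentiableAt_infty ?_ ?_ ?_ X
  · intro D D'
    simp only [jointDBar]
    rw [hg.dBar_eq_conj, hg.dBar_eq_conj, hg.dBar_eq_conj, hg.dHol_add_right, map_add]
  · intro c D
    exact hg.dBar_smul_left _ _ _ _
  · intro D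
    have hd := differentiable_bilin (f := fun B Q => dHol (fun w => g w B (A z)) (ρ z) Q)
      (fun B B' Q => hg.dHol_add_left Q B B' (A z)) (fun c B Q => hg.dHol_smul_left Q c B (A z))
      (fun B Q Q' => dHol_add_vec _ _ _ _) (fun c B Q => dHol_smul_vec _ _ _ _)
    have := dBar_holomorphic (hd (B z, Q z)).hasFDerivAt D
    have e : (fun y : V × V => jointDBar g (ρ z, A z, y))
        = fun y => conj (dHol (fun w => g w y.1 (A z)) (ρ z) y.2) := by
      funext y
      exact hg.dBar_eq_conj _ _ _
    rw [e, dHol_conj, this, map_zero]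

/-- Invariance of the curvature tensor under holomorphic changes of coordinates. -/
theorem curvatureTensor_pullback {g g' : V → V → V → ℂ} {ρ : V → V} {z : V}
    (hρ : ∀ᶠ w in 𝓝 z, ContDiffAt ℂ ω ρ w) (hg : IsMetricNear g (ρ z)) (hg' : IsMetricNear g' z)
    (h : ∀ᶠ w in 𝓝 z, ∀ X Y, g' w X Y = g (ρ w) (fderiv ℂ ρ w X) (fderiv ℂ ρ w Y))
    (X Y Z W : V) :
    curvatureTensor g' z X Y Z W = curvatureTensor g (ρ z) (fderiv ℂ ρ z X) (fderiv ℂ ρ z Y)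
      (fderiv ℂ ρ z Z) (fderiv ℂ ρ z W) := by
  have hρd : ∀ᶠ w in 𝓝 z, HasFDerivAt ρ (fderiv ℂ ρ w) w :=
    hρ.mono fun w hw => (hw.differentiableAt (by simp)).hasFDerivAt
  set H : V → V → V →L[ℂ] V := fun w Z => fderiv ℂ (fun w => fderiv ℂ ρ w Z) w with hH
  have hρ2 : ∀ᶠ w in 𝓝 z, ∀ Z, HasFDerivAt (fun w => fderiv ℂ ρ w Z) (H w Z) w := by
    filter_upwards [hρ] with w hw Z
    have h1 : ContDiffAt ℂ ω (fderiv ℂ ρ) w := hw.fderiv_right (by simp)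
    have h2 : DifferentiableAt ℂ (fun w => fderiv ℂ ρ w Z) w :=
      (h1.differentiableAt (by simp)).clm_apply (differentiableAt_const _)
    exact h2.hasFDerivAt
  have hH1 : ∀ Z, HasFDerivAt (fun w => H w Z Y) (fderiv ℂ (fun w => H w Z Y) z) z := by
    intro Z
    have h1 : ContDiffAt ℂ ω (fderiv ℂ ρ) z := hρ.self_of_nhds.fderiv_right (by simp)
    have h2 : ContDiffAt ℂ ω (fun w => fderiv ℂ ρ w Z) z := h1.clm_apply contDiffAt_const
    have h3 : ContDiffAt ℂ ω (fun w => H w Z) z := h2.fderiv_right (by simp)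
    exact ((h3.clm_apply contDiffAt_const).differentiableAt (by simp)).hasFDerivAt
  set D := fderiv ℂ ρ z with hD
  have hh := h.self_of_nhds
  -- Positivity of the pulled-back form forces `D` to be injective, hence bijective by dimension.
  have hinj : Function.Injective D := by
    rw [injective_iff_map_eq_zero]
    intro A hA
    by_contra hne
    have := hg'.posHerm.pos A hne
    rw [hh, ← hD, hA, hg.posHerm.zero_left] at this
    simp at this
  have hsurj : Function.Surjective D := LinearMap.surjective_of_injective (f := D.toLinearMap) hinj
  obtain ⟨Γ, hΓ⟩ := hg.exists_connection
  -- The transformation law of a connection: `D Γ'(X, Z) = Γ(D X, D Z) + ∂²ρ(X, Z)`.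
  choose Γ' hΓ' using fun X Z => hsurj (Γ (D X) (D Z) + H z Z X)
  have hρc := hρd.self_of_nhds.continuousAt
  have d1 : ∀ X Z W, dHol (fun w => g' w Z W) z X
      = dHol (fun w => g w (D Z) (D W)) (ρ z) (D X) + g (ρ z) (H z Z X) (D W) := by
    intro X Z W
    rw [dHol_congr (h.mono fun w hw => hw Z W)]
    exact dHol_jointForm hg hρd.self_of_nhds (hρ2.self_of_nhds Z) (hρ2.self_of_nhds W) X
  have hconn : ∀ X Z W, g' z (Γ' X Z) W = dHol (fun w => g' w Z W) z X := by
    intro X Z W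
    rw [d1, hh, ← hD, hΓ', hg.posHerm.add_left, hΓ]
  have d2 : (fun w => dBar (fun w' => g' w' Z W) w Y) =ᶠ[𝓝 z] fun w =>
      dBar (fun y => g y (fderiv ℂ ρ w Z) (fderiv ℂ ρ w W)) (ρ w) (fderiv ℂ ρ w Y)
        + g (ρ w) (fderiv ℂ ρ w Z) (H w W Y) := by
    filter_upwards [h.eventually_nhds, hρd, hρ2, hρc.eventually hg.eventually] with w h1 h2 h3 h4
    rw [dBar_congr (h1.mono fun w hw => hw Z W)]
    exact dBar_jointForm h4 h2 (h3 Z) (h3 W) Y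
  rw [hg'.curvatureTensor_eq hconn, hg.curvatureTensor_eq hΓ, dHol_congr d2, hh, ← hD, hΓ', hΓ']
  have r0 := hρd.self_of_nhds
  have r2 := hρ2.self_of_nhds
  have D1 : DifferentiableAt ℝ (fun w => dBar (fun y => g y (fderiv ℂ ρ w Z) (fderiv ℂ ρ w W)) (ρ w)
      (fderiv ℂ ρ w Y)) z := by
    have hc := (((r0.prodMk ((r2 Z).prodMk ((r2 W).prodMk (r2 Y))))).restrictScalars
      ℝ).differentiableAt
    exact DifferentiableAt.comp (g := jointDBar g) z
      (hg.contDiffAt_jointDBar _ _ _).differentiableAt_infty hc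
  have D2 : DifferentiableAt ℝ (fun w => g (ρ w) (fderiv ℂ ρ w Z) (H w W Y)) z := by
    have hc := ((r0.prodMk ((r2 Z).prodMk (hH1 W))).restrictScalars ℝ).differentiableAt
    exact DifferentiableAt.comp (g := jointForm g) z
      (hg.contDiffAt_jointForm _ _).differentiableAt_infty hc
  -- The terms in `∂²ρ` cancel against those in `Γ'`. No third derivative of `ρ` survives, since `H
  -- w W Y` sits in the conjugate linear slot.
  rw [dHol_add D1 D2, dHol_jointDBar hg r0 (r2 Z) (r2 W) (r2 Y), dHol_jointForm hg r0 (r2 Z) (hH1 W),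
    hg.posHerm.add_left, hg.posHerm.add_right, hg.posHerm.add_right, ← hD, ← hΓ, hg.dBar_eq_conj,
    ← hΓ, hg.posHerm.conj_symm]
  ring

end LocalMetrics

/-! ### Local bounds for the curvature -/

section CurvatureBounds

open Filter Topology

variable {V : Type*} [NormedAddCommGroup V] [NormedSpace ℂ V]

/-- A function of four vectors, homogeneous in each of them and continuous at the origin, is bounded
locally uniformly in a parameter. -/
theorem exists_bound_of_homogeneous {P : Type*} [TopologicalSpace P] {p : P}
    {N : P → V → V → V → V → ℝ} (hnn : ∀ w X Y Z W, 0 ≤ N w X Y Z W)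
    (h1 : ∀ᶠ w in 𝓝 p, ∀ (c : ℝ) X Y Z W, 0 < c → N w ((c : ℂ) • X) Y Z W = c * N w X Y Z W)
    (h2 : ∀ᶠ w in 𝓝 p, ∀ (c : ℝ) X Y Z W, 0 < c → N w X ((c : ℂ) • Y) Z W = c * N w X Y Z W)
    (h3 : ∀ᶠ w in 𝓝 p, ∀ (c : ℝ) X Y Z W, 0 < c → N w X Y ((c : ℂ) • Z) W = c * N w X Y Z W)
    (h4 : ∀ᶠ w in 𝓝 p, ∀ (c : ℝ) X Y Z W, 0 < c → N w X Y Z ((c : ℂ) • W) = c * N w X Y Z W)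
    (hc : ContinuousAt (fun q : P × V × V × V × V => N q.1 q.2.1 q.2.2.1 q.2.2.2.1 q.2.2.2.2)
      (p, 0, 0, 0, 0)) :
    ∃ C : ℝ, 0 ≤ C ∧ ∀ᶠ w in 𝓝 p, ∀ X Y Z W, N w X Y Z W ≤ C * (‖X‖ * ‖Y‖ * ‖Z‖ * ‖W‖) := by
  have hev := hc.eventually (gt_mem_nhds (lt_add_one _))
  set M := N p 0 0 0 0 + 1 with hM
  have hM0 : 0 ≤ M := add_nonneg (hnn _ _ _ _ _) zero_le_one
  rw [nhds_prod_eq, eventually_prod_iff] at hev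
  obtain ⟨pa, hpa, pb, hpb, hab⟩ := hev
  obtain ⟨δ, hδ, hball⟩ := Metric.eventually_nhds_iff.1 hpb
  -- `M` bounds `N` on vectors of length below `δ`; rescaling each of four nonzero vectors to length
  -- `δ/2` costs a factor `2/δ`. For a zero vector, scaling by `2` gives `N = 2 N`, so `N = 0`.
  refine ⟨M * (2 / δ) ^ 4, by positivity, ?_⟩
  filter_upwards [hpa, h1, h2, h3, h4] with w hw h1 h2 h3 h4 X Y Z W
  have key : ∀ X : V, X ≠ 0 → 0 < δ / (2 * ‖X‖) ∧ ‖((δ / (2 * ‖X‖) : ℝ) : ℂ) • X‖ < δ := by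
    intro X hX
    have hX' : 0 < ‖X‖ := norm_pos_iff.2 hX
    have hp : 0 < δ / (2 * ‖X‖) := by positivity
    refine ⟨hp, ?_⟩
    rw [norm_smul, Complex.norm_real, Real.norm_of_nonneg hp.le]
    have : δ / (2 * ‖X‖) * ‖X‖ = δ / 2 := by field_simp
    linarith
  have z1 : N w 0 Y Z W = 0 := by
    have := h1 2 0 Y Z W two_pos
    rw [smul_zero] at this
    linarith
  have z2 : N w X 0 Z W = 0 := by
    have := h2 2 X 0 Z W two_pos
    rw [smul_zero] at this
    linarith
  have z3 : N w X Y 0 W = 0 := by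
    have := h3 2 X Y 0 W two_pos
    rw [smul_zero] at this
    linarith
  have z4 : N w X Y Z 0 = 0 := by
    have := h4 2 X Y Z 0 two_pos
    rw [smul_zero] at this
    linarith
  by_cases hX : X = 0
  · subst hX; rw [z1]; simp
  by_cases hY : Y = 0
  · subst hY; rw [z2]; simp
  by_cases hZ : Z = 0
  · subst hZ; rw [z3]; simp
  by_cases hW : W = 0
  · subst hW; rw [z4]; simp
  obtain ⟨aX, bX⟩ := key X hX
  obtain ⟨aY, bY⟩ := key Y hY
  obtain ⟨aZ, bZ⟩ := key Z hZ
  obtain ⟨aW, bW⟩ := key W hW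
  have hq := hab hw (hball (y := (((δ / (2 * ‖X‖) : ℝ) : ℂ) • X, ((δ / (2 * ‖Y‖) : ℝ) : ℂ) • Y,
    ((δ / (2 * ‖Z‖) : ℝ) : ℂ) • Z, ((δ / (2 * ‖W‖) : ℝ) : ℂ) • W)) (by
      have e : ((0 : V), (0 : V), (0 : V), (0 : V)) = 0 := rfl
      rw [e, dist_zero_right]
      simp only [Prod.norm_def, max_lt_iff]
      exact ⟨bX, bY, bZ, bW⟩))
  simp only at hq
  rw [h1 _ _ _ _ _ aX, h2 _ _ _ _ _ aY, h3 _ _ _ _ _ aZ, h4 _ _ _ _ _ aW] at hq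
  have nX : 0 < ‖X‖ := norm_pos_iff.2 hX
  have nY : 0 < ‖Y‖ := norm_pos_iff.2 hY
  have nZ : 0 < ‖Z‖ := norm_pos_iff.2 hZ
  have nW : 0 < ‖W‖ := norm_pos_iff.2 hW
  have e : N w X Y Z W = (δ / (2 * ‖X‖) * (δ / (2 * ‖Y‖) * (δ / (2 * ‖Z‖) * (δ / (2 * ‖W‖) *
      N w X Y Z W)))) * ((2 / δ) ^ 4 * (‖X‖ * ‖Y‖ * ‖Z‖ * ‖W‖)) := by
    field_simp
  rw [e, mul_assoc M]
  exact mul_le_mul_of_nonneg_right hq.le (by positivity)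

variable [FiniteDimensional ℂ V]

theorem curvatureTensor_smul₁ (g : V → V → V → ℂ) (p : V) (c : ℂ) (X Y Z W : V) :
    curvatureTensor g p (c • X) Y Z W = c * curvatureTensor g p X Y Z W := by
  simp only [curvatureTensor, dHol_smul_vec, mul_add, Finset.mul_sum]
  congr 1
  · ring
  · refine Finset.sum_congr rfl fun i _ => Finset.sum_congr rfl fun j _ => ?_
    ring

theorem curvatureTensor_smul₂ (g : V → V → V → ℂ) (p : V) (c : ℂ) (X Y Z W : V) :
    curvatureTensor g p X (c • Y) Z W = conj c * curvatureTensor g p X Y Z W := by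
  simp only [curvatureTensor, dBar_smul_vec, dHol_const_mul, mul_add, Finset.mul_sum]
  congr 1
  · ring
  · refine Finset.sum_congr rfl fun i _ => Finset.sum_congr rfl fun j _ => ?_
    ring

namespace IsMetricNear

variable {g : V → V → V → ℂ} {p : V} (hg : IsMetricNear g p)

include hg

theorem curvatureTensor_smul₃ (c : ℂ) (X Y Z W : V) :
    curvatureTensor g p X Y (c • Z) W = c * curvatureTensor g p X Y Z W := by
  simp only [curvatureTensor]
  rw [dHol_congr (hg.eventually.mono fun w hw => hw.dBar_smul_left Y c Z W)]
  simp only [dHol_const_mul, hg.dHol_smul_left, mul_add, Finset.mul_sum]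
  congr 1
  · ring
  · refine Finset.sum_congr rfl fun i _ => Finset.sum_congr rfl fun j _ => ?_
    ring

theorem curvatureTensor_smul₄ (c : ℂ) (X Y Z W : V) :
    curvatureTensor g p X Y Z (c • W) = conj c * curvatureTensor g p X Y Z W := by
  simp only [curvatureTensor]
  rw [dHol_congr (hg.eventually.mono fun w hw => hw.dBar_smul_right Y c Z W)]
  simp only [dHol_const_mul, hg.dBar_smul_right, mul_add, Finset.mul_sum]
  congr 1
  · ring
  · refine Finset.sum_congr rfl fun i _ => Finset.sum_congr rfl fun j _ => ?_
    ring

/-- Cramer's rule: the entry is an adjugate entry divided by a nonvanishing determinant, both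
continuous. -/
theorem continuousAt_gram_inv (i j : Fin (Module.finrank ℂ V)) :
    ContinuousAt (fun w => (gram g w)⁻¹ i j) p := by
  have hG : ContinuousAt (gram g) p :=
    continuousAt_pi.2 fun i => continuousAt_pi.2 fun j => (hg.contDiffAt _ _).continuousAt
  have hdet : ContinuousAt (fun w => (gram g w).det) p :=
    (continuous_id.matrix_det.continuousAt (x := gram g p)).comp hG
  have hadj : ContinuousAt (fun w => (gram g w).adjugate i j) p :=
    ((continuous_id.matrix_adjugate.matrix_elem i j).continuousAt (x := gram g p)).comp hG
  simp only [Matrix.inv_def, Matrix.smul_apply, Ring.inverse_eq_inv', smul_eq_mul]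
  exact (hdet.inv₀ hg.posHerm.isUnit_det_gram.ne_zero).mul hadj

theorem dHol_jointDBar_fst (A B Q P : V) : dHol (jointDBar g) (p, A, B, Q) (P, 0, 0, 0)
    = dHol (fun w => dBar (fun w' => g w' A B) w Q) p P := by
  have c1 : HasFDerivAt (fun y : V => (y, A, B, Q))
      ((ContinuousLinearMap.id ℂ V).prod (0 : V →L[ℂ] V × V × V)) p :=
    (hasFDerivAt_id (𝕜 := ℂ) p).prodMk (hasFDerivAt_const _ _)
  exact (dHol_comp (F := jointDBar g) (c := fun y : V => (y, A, B, Q))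
    (hg.contDiffAt_jointDBar A B Q).differentiableAt_infty c1 P).symm

/-- Each derivative in the curvature is a directional derivative of a jointly smooth function, taken
along a base direction that itself varies continuously. -/
theorem continuousAt_curvatureTensor (X Y Z W : V) :
    ContinuousAt (fun q : V × V × V × V × V =>
      curvatureTensor g q.1 q.2.1 q.2.2.1 q.2.2.2.1 q.2.2.2.2) (p, X, Y, Z, W) := by
  set b := Module.finBasis ℂ V with hb
  have e : (fun q : V × V × V × V × V =>
      curvatureTensor g q.1 q.2.1 q.2.2.1 q.2.2.2.1 q.2.2.2.2) =ᶠ[𝓝 (p, X, Y, Z, W)] fun q =>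
      - dHol (jointDBar g) (q.1, q.2.2.2.1, q.2.2.2.2, q.2.2.1) (q.2.1, 0, 0, 0)
        + ∑ i, ∑ j, (gram g q.1)⁻¹ j i * dHol (jointForm g) (q.1, q.2.2.2.1, b j) (q.2.1, 0, 0)
          * dBar (jointForm g) (q.1, b i, q.2.2.2.2) (q.2.2.1, 0, 0) := by
    filter_upwards [(continuousAt_fst (p := (p, X, Y, Z, W))).eventually hg.eventually] with q hq
    simp only [curvatureTensor, hq.dHol_jointDBar_fst, hq.dHol_jointForm_fst, hq.dBar_jointForm_fst,
      ← hb]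
  refine ContinuousAt.congr ?_ e.symm
  have c1 := (contDiffAt_dHol_joint (f := jointDBar g)
    (c := fun q : V × V × V × V × V => (q.1, q.2.2.2.1, q.2.2.2.2, q.2.2.1))
    (X := fun q : V × V × V × V × V => (q.2.1, 0, 0, 0)) (q := (p, X, Y, Z, W))
    (hg.contDiffAt_jointDBar _ _ _) (by fun_prop) (by fun_prop)).continuousAt
  refine c1.neg.add ?_
  refine tendsto_finsetSum _ fun i _ => tendsto_finsetSum _ fun j _ => ?_
  have c2 := (contDiffAt_dHol_joint (f := jointForm g)
    (c := fun q : V × V × V × V × V => (q.1, q.2.2.2.1, b j))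
    (X := fun q : V × V × V × V × V => (q.2.1, 0, 0)) (q := (p, X, Y, Z, W))
    (hg.contDiffAt_jointForm _ _) (by fun_prop) (by fun_prop)).continuousAt
  have c3 := (contDiffAt_dBar_joint (f := jointForm g)
    (c := fun q : V × V × V × V × V => (q.1, b i, q.2.2.2.2))
    (X := fun q : V × V × V × V × V => (q.2.2.1, 0, 0)) (q := (p, X, Y, Z, W))
    (hg.contDiffAt_jointForm _ _) (by fun_prop) (by fun_prop)).continuousAt
  have c0 : ContinuousAt (fun q : V × V × V × V × V => (gram g q.1)⁻¹ j i) (p, X, Y, Z, W) :=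
    ContinuousAt.comp (f := Prod.fst) (g := fun w => (gram g w)⁻¹ j i) (x := (p, X, Y, Z, W))
      (hg.continuousAt_gram_inv j i) continuousAt_fst
  exact (c0.mul c2).mul c3

/-- Locally, a metric dominates the norm. -/
theorem exists_len_ge : ∃ c : ℝ, 0 < c ∧ ∀ᶠ w in 𝓝 p, ∀ X, c * ‖X‖ ≤ len g w X := by
  have hfd : FiniteDimensional ℝ V := FiniteDimensional.complexToReal V
  have : ProperSpace V := FiniteDimensional.proper_real V
  have hK : IsCompact (Metric.sphere (0 : V) 1) := isCompact_sphere 0 1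
  have hcont : ∀ X : V, ContinuousAt (fun q : V × V => (g q.1 q.2 q.2).re) (p, X) := by
    intro X
    have h1 : ContinuousAt (fun q : V × V => jointForm g (q.1, q.2, q.2)) (p, X) :=
      ContinuousAt.comp (f := fun q : V × V => (q.1, q.2, q.2)) (g := jointForm g) (x := (p, X))
        (hg.contDiffAt_jointForm X X).continuousAt (by fun_prop)
    exact Complex.continuous_re.continuousAt.comp h1
  obtain ⟨m, hm, hm2⟩ : ∃ m : ℝ, 0 < m ∧ ∀ X ∈ Metric.sphere (0 : V) 1, m < (g p X X).re := by
    -- The sphere is empty when `V` is zero, which occurs for a zero-dimensional base.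
    rcases (Metric.sphere (0 : V) 1).eq_empty_or_nonempty with h | h
    · exact ⟨1, one_pos, fun X hX => by rw [h] at hX; exact hX.elim⟩
    · have hc : ContinuousOn (fun X => (g p X X).re) (Metric.sphere (0 : V) 1) := fun X _ =>
        (ContinuousAt.comp (f := fun X : V => (p, X)) (x := X) (hcont X)
          (by fun_prop)).continuousWithinAt
      obtain ⟨X₀, hX₀, hmin⟩ := hK.exists_isMinOn h hc
      have hpos := hg.posHerm.pos X₀ (by
        rintro rfl
        simp at hX₀)
      refine ⟨(g p X₀ X₀).re / 2, by positivity, fun X hX => ?_⟩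
      have := hmin hX
      simp only [Set.mem_ofPred_eq] at this
      linarith
  -- Compactness of the sphere makes the neighbourhood of `p` independent of `X`.
  have hev : ∀ᶠ w in 𝓝 p, ∀ X ∈ Metric.sphere (0 : V) 1, m < (g w X X).re := by
    refine hK.eventually_forall_of_forall_eventually fun X hX => ?_
    exact (hcont X).eventually (lt_mem_nhds (hm2 X hX))
  refine ⟨Real.sqrt m, Real.sqrt_pos.2 hm, ?_⟩
  filter_upwards [hev, hg] with w hw hw2 X
  by_cases hX : X = 0
  · subst hX; simp [len, Real.sqrt_nonneg]
  have nX : 0 < ‖X‖ := norm_pos_iff.2 hX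
  have h1 := hw (((‖X‖⁻¹ : ℝ) : ℂ) • X) (by
    rw [mem_sphere_zero_iff_norm, norm_smul, Complex.norm_real, norm_inv, norm_norm,
      inv_mul_cancel₀ nX.ne'])
  rw [hw2.1.smul_left, hw2.1.smul_right, Complex.conj_ofReal, Complex.re_ofReal_mul,
    Complex.re_ofReal_mul] at h1
  apply Real.le_sqrt_of_sq_le
  rw [mul_pow, Real.sq_sqrt hm.le]
  have e : (g w X X).re = ‖X‖⁻¹ * (‖X‖⁻¹ * (g w X X).re) * ‖X‖ ^ 2 := by field_simp
  rw [e]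
  exact mul_le_mul_of_nonneg_right h1.le (by positivity)

/-- The norm of the curvature tensor is locally bounded. -/
theorem exists_curvatureLE : ∃ K : ℝ, 0 ≤ K ∧ ∀ᶠ w in 𝓝 p, CurvatureLE g w K := by
  obtain ⟨c, hc, hlen⟩ := hg.exists_len_ge
  obtain ⟨C, hC, hbd⟩ := exists_bound_of_homogeneous (p := p)
    (N := fun w X Y Z W => ‖curvatureTensor g w X Y Z W‖) (fun _ _ _ _ _ => norm_nonneg _)
    (Eventually.of_forall fun w a X Y Z W ha => by
      rw [curvatureTensor_smul₁, norm_mul, Complex.norm_real, Real.norm_of_nonneg ha.le])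
    (Eventually.of_forall fun w a X Y Z W ha => by
      rw [curvatureTensor_smul₂, Complex.conj_ofReal, norm_mul, Complex.norm_real,
        Real.norm_of_nonneg ha.le])
    (hg.eventually.mono fun w hw a X Y Z W ha => by
      rw [hw.curvatureTensor_smul₃, norm_mul, Complex.norm_real, Real.norm_of_nonneg ha.le])
    (hg.eventually.mono fun w hw a X Y Z W ha => by
      rw [hw.curvatureTensor_smul₄, Complex.conj_ofReal, norm_mul, Complex.norm_real,
        Real.norm_of_nonneg ha.le])
    (hg.continuousAt_curvatureTensor 0 0 0 0).norm
  refine ⟨C / c ^ 4, by positivity, ?_⟩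
  filter_upwards [hlen, hbd] with w h1 h2 X Y Z W
  refine (h2 X Y Z W).trans ?_
  have l : ∀ X, ‖X‖ ≤ len g w X / c := fun X => by
    rw [le_div_iff₀ hc, mul_comm]; exact h1 X
  have l0 : ∀ X, 0 ≤ len g w X / c := fun X => (norm_nonneg _).trans (l X)
  calc C * (‖X‖ * ‖Y‖ * ‖Z‖ * ‖W‖)
      ≤ C * (len g w X / c * (len g w Y / c) * (len g w Z / c) * (len g w W / c)) := by
        have := l0 X
        have := l0 Y
        have := l0 Z
        gcongr <;> exact l _
    _ = _ := by field_simp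

end IsMetricNear

end CurvatureBounds

/-! ### Chart independence and the global curvature bound -/

section KahlerCharts

open Filter Topology

variable {E : Type*} [NormedAddCommGroup E] [NormedSpace ℂ E]
  {D : Type*} [TopologicalSpace D] [ChartedSpace E D] [IsManifold 𝓘(ℂ, E) ω D]

theorem KahlerMetric.isPosHermForm_chartForm (θ : KahlerMetric E D) (x : D) {z : E}
    (hz : z ∈ (chartAt E x).target) : IsPosHermForm (chartForm θ.form x z) where
  add_left X X' Y := by
    have key : ∀ (F : E →ₗ[ℂ] E →ₗ⋆[ℂ] ℂ) (A : E →L[ℂ] E),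
        F (A (X + X')) (A Y) = F (A X) (A Y) + F (A X') (A Y) := fun F A => by simp
    exact key (θ.form _) (mfderiv 𝓘(ℂ, E) 𝓘(ℂ, E) (chartAt E x).symm z)
  smul_left c X Y := by
    have key : ∀ (F : E →ₗ[ℂ] E →ₗ⋆[ℂ] ℂ) (A : E →L[ℂ] E),
        F (A (c • X)) (A Y) = c * F (A X) (A Y) := fun F A => by simp
    exact key (θ.form _) (mfderiv 𝓘(ℂ, E) 𝓘(ℂ, E) (chartAt E x).symm z)
  conj_symm X Y := θ.conj_symm _ _ _
  pos X hX := by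
    have : IsManifold 𝓘(ℂ, E) 1 D := IsManifold.of_le (n := ω) (by simp)
    have hinj := (mdifferentiable_chart (I := 𝓘(ℂ, E)) x).symm.mfderiv_injective
      (x := z) (by simpa using hz)
    refine θ.pos _ _ fun h0 => hX (hinj ?_)
    rw [h0]
    exact (map_zero _).symm

theorem KahlerMetric.isMetricNear_chartForm (θ : KahlerMetric E D) (x : D) {z : E}
    (hz : z ∈ (chartAt E x).target) : IsMetricNear (chartForm θ.form x) z := by
  have ho := (chartAt E x).open_target
  filter_upwards [ho.mem_nhds hz] with w hw
  exact ⟨θ.isPosHermForm_chartForm x hw, fun X Y => (θ.smooth x X Y).contDiffAt (ho.mem_nhds hw)⟩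

/-- Near `z` the inverse chart at `y` is the inverse chart at `x` composed with the transition map;
the chain rule does the rest. -/
theorem KahlerMetric.chartForm_eq_pullback (θ : KahlerMetric E D) (x y : D) {z : E}
    (hz : z ∈ ((chartAt E y).symm ≫ₕ chartAt E x).source) (X Y : E) :
    chartForm θ.form y z X Y = chartForm θ.form x (((chartAt E y).symm ≫ₕ chartAt E x) z)
      (fderiv ℂ ((chartAt E y).symm ≫ₕ chartAt E x) z X)
      (fderiv ℂ ((chartAt E y).symm ≫ₕ chartAt E x) z Y) := by
  have : IsManifold 𝓘(ℂ, E) 1 D := IsManifold.of_le (n := ω) (by simp)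
  set ρ := (chartAt E y).symm ≫ₕ chartAt E x with hρ
  have hz1 : z ∈ (chartAt E y).target := by
    rw [hρ, OpenPartialHomeomorph.trans_source] at hz; exact hz.1
  have hz2 : (chartAt E y).symm z ∈ (chartAt E x).source := by
    rw [hρ, OpenPartialHomeomorph.trans_source] at hz; exact hz.2
  have hev : (chartAt E y).symm =ᶠ[𝓝 z] (chartAt E x).symm ∘ ρ := by
    filter_upwards [ρ.open_source.mem_nhds hz] with w hw
    rw [hρ, OpenPartialHomeomorph.trans_source] at hw
    simp only [hρ, Function.comp, OpenPartialHomeomorph.coe_trans]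
    exact ((chartAt E x).left_inv hw.2).symm
  have hρz : ρ z ∈ (chartAt E x).target := (chartAt E x).map_source hz2
  have d1 := (mdifferentiable_chart (I := 𝓘(ℂ, E)) x).symm.mdifferentiableAt (x := ρ z)
    (by simpa using hρz)
  have d2 : MDifferentiableAt 𝓘(ℂ, E) 𝓘(ℂ, E) ρ z :=
    MDifferentiableAt.comp (I' := 𝓘(ℂ, E)) (g := chartAt E x) (f := (chartAt E y).symm) z
      ((mdifferentiable_chart (I := 𝓘(ℂ, E)) x).mdifferentiableAt hz2)
      ((mdifferentiable_chart (I := 𝓘(ℂ, E)) y).symm.mdifferentiableAt (by simpa using hz1))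
  have hmf : ∀ X : E, mfderiv 𝓘(ℂ, E) 𝓘(ℂ, E) (chartAt E y).symm z X
      = mfderiv 𝓘(ℂ, E) 𝓘(ℂ, E) (chartAt E x).symm (ρ z) (fderiv ℂ ρ z X) := by
    intro X
    rw [hev.mfderiv_eq, mfderiv_comp z d1 d2, mfderiv_eq_fderiv]
    rfl
  have hpt : (chartAt E y).symm z = (chartAt E x).symm (ρ z) := hev.self_of_nhds
  -- The two base points are equal only propositionally, so the form is transported with all tangent
  -- spaces read as `E`.
  have key : ∀ (p q : D) (A B : E), p = q → (θ.form p : E → E →ₗ⋆[ℂ] ℂ) A B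
      = (θ.form q : E → E →ₗ⋆[ℂ] ℂ) A B := by
    rintro p q A B rfl
    rfl
  have h1 := key _ _ (mfderiv 𝓘(ℂ, E) 𝓘(ℂ, E) (chartAt E y).symm z X)
    (mfderiv 𝓘(ℂ, E) 𝓘(ℂ, E) (chartAt E y).symm z Y) hpt
  refine h1.trans ?_
  rw [hmf X, hmf Y]
  rfl

theorem contDiffAt_transition (x y : D) {z : E}
    (hz : z ∈ ((chartAt E y).symm ≫ₕ chartAt E x).source) :
    ContDiffAt ℂ ω ((chartAt E y).symm ≫ₕ chartAt E x) z := by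
  have h := StructureGroupoid.compatible (contDiffGroupoid ω 𝓘(ℂ, E)) (chart_mem_atlas E y)
    (chart_mem_atlas E x)
  rw [contDiffGroupoid, mem_groupoid_of_pregroupoid] at h
  have h2 : ContDiffOn ℂ ω ((chartAt E y).symm ≫ₕ chartAt E x)
      ((chartAt E y).symm ≫ₕ chartAt E x).source := by
    simpa [contDiffPregroupoid, ContDiffOn] using h.1
  exact h2.contDiffAt (((chartAt E y).symm ≫ₕ chartAt E x).open_source.mem_nhds hz)

variable [FiniteDimensional ℂ E]

theorem CurvatureLE.mono {V : Type*} [NormedAddCommGroup V] [NormedSpace ℂ V]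
    [FiniteDimensional ℂ V] {g : V → V → V → ℂ} {z : V} {K K' : ℝ}
    (h : CurvatureLE g z K) (hK : K ≤ K') : CurvatureLE g z K' := fun X Y Z W => by
  refine (h X Y Z W).trans (mul_le_mul_of_nonneg_right hK ?_)
  simp only [len]
  positivity

/-- The norm of the curvature tensor does not depend on the chart. -/
theorem KahlerMetric.curvatureLE_chart (θ : KahlerMetric E D) (x y : D) {z : E}
    (hz : z ∈ ((chartAt E y).symm ≫ₕ chartAt E x).source) {K : ℝ}
    (h : CurvatureLE (chartForm θ.form x) (((chartAt E y).symm ≫ₕ chartAt E x) z) K) :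
    CurvatureLE (chartForm θ.form y) z K := by
  set ρ := (chartAt E y).symm ≫ₕ chartAt E x with hρ
  have hz1 : z ∈ (chartAt E y).target := by
    rw [hρ, OpenPartialHomeomorph.trans_source] at hz; exact hz.1
  have hz2 : ρ z ∈ (chartAt E x).target := by
    rw [hρ, OpenPartialHomeomorph.trans_source] at hz; exact (chartAt E x).map_source hz.2
  have hn := ρ.open_source.mem_nhds hz
  have hpull : ∀ᶠ w in 𝓝 z, ∀ X Y, chartForm θ.form y w X Y
      = chartForm θ.form x (ρ w) (fderiv ℂ ρ w X) (fderiv ℂ ρ w Y) := by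
    filter_upwards [hn] with w hw X Y
    exact θ.chartForm_eq_pullback x y hw X Y
  intro X Y Z W
  rw [curvatureTensor_pullback (by filter_upwards [hn] with w hw using contDiffAt_transition x y hw)
     (θ.isMetricNear_chartForm x hz2)
    (θ.isMetricNear_chartForm y hz1) hpull]
  simp only [len, hpull.self_of_nhds]
  exact h _ _ _ _

/-- On a compact manifold, the norm of the curvature tensor is bounded. -/
theorem KahlerMetric.exists_curvatureLE [CompactSpace D] (θ : KahlerMetric E D) :
    ∃ K : ℝ, 0 ≤ K ∧ ∀ x, CurvatureLE (chartForm θ.form x) (chartAt E x x) K := by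
  have key : ∃ K : ℝ, 0 ≤ K ∧
      ∀ x ∈ (Set.univ : Set D), CurvatureLE (chartForm θ.form x) (chartAt E x x) K := by
    refine isCompact_univ.induction_on (p := fun S => ∃ K : ℝ, 0 ≤ K ∧
      ∀ x ∈ S, CurvatureLE (chartForm θ.form x) (chartAt E x x) K) ?_ ?_ ?_ ?_
    · exact ⟨0, le_rfl, fun x hx => hx.elim⟩
    · rintro S T hST ⟨K, hK, h⟩
      exact ⟨K, hK, fun x hx => h x (hST hx)⟩
    · rintro S T ⟨K, hK, h⟩ ⟨K', hK', h'⟩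
      refine ⟨max K K', le_max_of_le_left hK, fun x hx => ?_⟩
      rcases hx with hx | hx
      · exact (h x hx).mono (le_max_left _ _)
      · exact (h' x hx).mono (le_max_right _ _)
    -- A bound valid near `x` in the chart at `x` is transferred, for each nearby `y`, to the chart
    -- at `y`.
    · intro x _
      obtain ⟨K, hK, hev⟩ := (θ.isMetricNear_chartForm x (mem_chart_target E x)).exists_curvatureLE
      have hc : ContinuousAt (chartAt E x) x := (chartAt E x).continuousAt (mem_chart_source E x)
      have h2 := (hc.eventually hev).and ((chartAt E x).open_source.mem_nhds (mem_chart_source E x))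
      refine ⟨_, mem_nhdsWithin_of_mem_nhds h2, K, hK, fun y hy => ?_⟩
      refine θ.curvatureLE_chart x y (z := chartAt E y y) ?_ ?_
      · rw [OpenPartialHomeomorph.trans_source]
        refine ⟨by simp, ?_⟩
        simp only [Set.mem_preimage]
        rw [(chartAt E y).left_inv (mem_chart_source E y)]
        exact hy.2
      · simp only [OpenPartialHomeomorph.coe_trans, Function.comp]
        rw [(chartAt E y).left_inv (mem_chart_source E y)]
        exact hy.1
  obtain ⟨K, hK, h⟩ := key
  exact ⟨K, hK, fun x => h x (Set.mem_univ x)⟩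

end KahlerCharts

/-! ### The function `log |w|² + ψ(z)` -/

section LogNorm

open Filter Topology

variable {E : Type*} [NormedAddCommGroup E] [NormedSpace ℂ E]

theorem hasDHol_snd (q X : E × ℂ) : HasDHol (fun q : E × ℂ => q.2) q X X.2 :=
  ⟨(hasFDerivAt_snd (𝕜 := ℂ) (p := q)).differentiableAt.restrictScalars ℝ,
    dHol_holomorphic hasFDerivAt_snd X⟩

theorem hasDHol_conj_snd (q X : E × ℂ) : HasDHol (fun q : E × ℂ => conj q.2) q X 0 := by
  refine ⟨?_, ?_⟩
  · exact Complex.conjCLE.differentiableAt.comp q (hasDHol_snd q X).diff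
  · rw [dHol_conj, dBar_holomorphic hasFDerivAt_snd, map_zero]

/-- The function `log |w|² + ψ(z)`. -/
def logNorm (ψ : E → ℝ) (q : E × ℂ) : ℝ := Real.log (‖q.2‖ ^ 2) + ψ q.1

variable {ψ : E → ℝ} {q : E × ℂ}

theorem contDiffAt_log_norm_snd (hq : q.2 ≠ 0) :
    ContDiffAt ℝ ∞ (fun q : E × ℂ => Real.log (‖q.2‖ ^ 2)) q :=
  (((contDiff_snd (𝕜 := ℝ)).norm_sq ℝ).contDiffAt).log (by simpa using hq)

theorem contDiffAt_logNorm (hq : q.2 ≠ 0) (hψ : ContDiffAt ℝ ∞ ψ q.1) :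
    ContDiffAt ℝ ∞ (logNorm ψ) q :=
  (contDiffAt_log_norm_snd hq).add (hψ.comp q contDiffAt_fst)

/-- Since `∂(w w̄) = w̄ dw`, the logarithm contributes `dw / w`. -/
theorem dHol_logNorm (hq : q.2 ≠ 0) (hψ : ContDiffAt ℝ ∞ ψ q.1) (X : E × ℂ) :
    dHol (fun w => (logNorm ψ w : ℂ)) q X = X.2 / q.2 + dHol (fun w => (ψ w : ℂ)) q.1 X.1 := by
  have hN : HasDHol (fun q : E × ℂ => ((‖q.2‖ ^ 2 : ℝ) : ℂ)) q X (conj q.2 * X.2) := by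
    have h := (hasDHol_snd q X).mul (hasDHol_conj_snd q X)
    have e : (fun q : E × ℂ => ((‖q.2‖ ^ 2 : ℝ) : ℂ)) = fun q : E × ℂ => q.2 * conj q.2 := by
      funext q
      rw [Complex.mul_conj']; simp
    rw [e]
    simpa using h
  have hq' : ‖q.2‖ ^ 2 ≠ 0 := by simpa using hq
  have h1 := hasDHol_ofReal_comp (φ := Real.log) (t := fun q : E × ℂ => ‖q.2‖ ^ 2) (z := q)
    (Real.hasDerivAt_log hq')
    (((contDiff_snd (𝕜 := ℝ) (n := 1)).norm_sq ℝ).differentiable (by simp) q) X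
  have h2 : HasDHol (fun q : E × ℂ => (ψ q.1 : ℂ)) q X (dHol (fun w => (ψ w : ℂ)) q.1 X.1) :=
    ⟨hψ.ofReal_complex.differentiableAt_infty.comp q differentiableAt_fst,
      dHol_comp (c := Prod.fst) (F := fun w => (ψ w : ℂ)) hψ.ofReal_complex.differentiableAt_infty
        hasFDerivAt_fst X⟩
  have h3 := (h1.add h2).eq
  rw [hN.eq] at h3
  simp only [logNorm]
  push_cast at h3 ⊢
  rw [h3]
  congr 1
  have : ((‖q.2‖ : ℂ) ^ 2) = q.2 * conj q.2 := (Complex.mul_conj' q.2).symm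
  rw [this]
  have hc : conj q.2 ≠ 0 := by simpa using hq
  field_simp

/-- The fibre contribution `dw / w` is holomorphic, so `∂̄` kills it. This is the source of the
degeneracy of `∂∂̄t` along the fibres. -/
theorem ddbar_logNorm (hq : q.2 ≠ 0) (hψ : ∀ᶠ z in 𝓝 q.1, ContDiffAt ℝ ∞ ψ z) (X Y : E × ℂ) :
    ddbar (logNorm ψ) q X Y = ddbar ψ q.1 X.1 Y.1 := by
  have h0 := hψ.self_of_nhds
  rw [← dBar_dHol_ofReal (contDiffAt_logNorm hq h0), ← dBar_dHol_ofReal h0]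
  have hne : ∀ᶠ w : E × ℂ in 𝓝 q, w.2 ≠ 0 := continuousAt_snd.eventually_ne hq
  have e : (fun w => dHol (fun w' => (logNorm ψ w' : ℂ)) w X) =ᶠ[𝓝 q] fun w =>
      X.2 / w.2 + dHol (fun w => (ψ w : ℂ)) w.1 X.1 := by
    filter_upwards [hne, continuousAt_fst.eventually hψ] with w h1 h2
    exact dHol_logNorm h1 h2 X
  rw [dBar_congr e]
  have hd : DifferentiableAt ℂ (fun w : E × ℂ => X.2 / w.2) q :=
    by
      simp only [div_eq_mul_inv]
      exact (differentiableAt_snd.inv hq).const_mul _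
  have hd2 := (contDiffAt_dHol h0.ofReal_complex X.1).differentiableAt_infty
  have hd3 : DifferentiableAt ℝ (fun w : E × ℂ => dHol (fun w => (ψ w : ℂ)) w.1 X.1) q :=
    hd2.comp q differentiableAt_fst
  rw [dBar_add (hd.restrictScalars ℝ) hd3, dBar_holomorphic hd.hasFDerivAt, zero_add]
  exact dBar_comp (c := Prod.fst) (F := fun w => dHol (fun w => (ψ w : ℂ)) w X.1) hd2
    hasFDerivAt_fst Y

end LogNorm

/-! ### Local frames and charts of the total space -/

section FrameDomain

variable {E : Type*} [NormedAddCommGroup E] {D : Type*} [TopologicalSpace D] [ChartedSpace E D]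
  {L : D → Type*} [TopologicalSpace (TotalSpace ℂ L)] [∀ x, TopologicalSpace (L x)]
  [FiberBundle ℂ L]

theorem isOpen_frameDomain (x : D) : IsOpen (frameDomain E L x) :=
  (chartAt E x).isOpen_inter_preimage_symm (trivializationAt ℂ L x).open_baseSet

theorem mem_frameDomain (x : D) : chartAt E x x ∈ frameDomain E L x := by
  refine ⟨mem_chart_target E x, ?_⟩
  simp only [Set.mem_preimage]
  rw [(chartAt E x).left_inv (mem_chart_source E x)]
  exact mem_baseSet_trivializationAt ℂ L x

end FrameDomain

section TotalSpaceCharts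

open Filter Topology

variable {E : Type*} [NormedAddCommGroup E] [NormedSpace ℂ E]
  {D : Type*} [TopologicalSpace D] [ChartedSpace E D]
  {L : D → Type*} [TopologicalSpace (TotalSpace ℂ L)] [∀ x, AddCommGroup (L x)]
  [∀ x, Module ℂ (L x)] [∀ x, TopologicalSpace (L x)] [FiberBundle ℂ L]

namespace HermitianMetric

variable (h : HermitianMetric E L)

theorem normSq_smul (y : D) (w : ℂ) (u : L y) :
    h.normSq ⟨y, w • u⟩ = ‖w‖ ^ 2 * h.normSq ⟨y, u⟩ := by
  have e : h.inner y (w • u) (w • u) = ((‖w‖ ^ 2 : ℝ) : ℂ) * h.inner y u u := by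
    rw [LinearMap.map_smul, LinearMap.smul_apply, LinearMap.map_smulₛₗ, smul_eq_mul, smul_eq_mul, ← mul_assoc,
      Complex.mul_conj']
    simp
  simp only [normSq]
  rw [e, Complex.re_ofReal_mul]

/-- The function `log ‖e‖_h²`, where `e` is the local frame at `x`, in the chart at `x`. -/
def logFrameNormSq (x : D) (z : E) : ℝ :=
  Real.log (h.normSq ⟨(chartAt E x).symm z, localFrame L x ((chartAt E x).symm z)⟩)

/-- The curvature form is minus `∂∂̄` of the log norm of the frame; hence the hypothesis with `-s`,
that is `s = -σ`. -/
theorem ddbar_logFrameNormSq {s : ℝ} {θ : KahlerMetric E D} (hθ : h.CurvatureEq (-s) θ) (x : D)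
    {z : E} (hz : z ∈ frameDomain E L x) (X Y : E) :
    ddbar (h.logFrameNormSq x) z X Y = s * chartForm θ.form x z X Y := by
  have := hθ x z hz X Y
  have e : h.curvatureForm x z X Y = - ddbar (h.logFrameNormSq x) z X Y := rfl
  rw [e] at this
  push_cast at this
  linear_combination -this

end HermitianMetric

variable [VectorBundle ℂ ℂ L]

theorem trivialization_symm_eq_smul (x : D) {y : D} (hy : y ∈ (trivializationAt ℂ L x).baseSet)
    (w : ℂ) : (trivializationAt ℂ L x).symm y w = w • localFrame L x y := by
  rw [localFrame, ← Trivialization.symmₗ_apply (R := ℂ) _ hy, ← Trivialization.symmₗ_apply (R := ℂ) _ hy,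
    ← map_smul, smul_eq_mul, mul_one]

theorem localFrame_ne_zero (x : D) {y : D} (hy : y ∈ (trivializationAt ℂ L x).baseSet) :
    localFrame L x y ≠ 0 := by
  intro h0
  have h := Trivialization.linearMapAt_symm (R := ℂ) (trivializationAt ℂ L x) hy 1
  have h1 : (trivializationAt ℂ L x).symm y 1 = 0 := h0
  rw [h1, map_zero] at h
  exact zero_ne_one h

namespace HermitianMetric

variable (h : HermitianMetric E L)

theorem normSq_frame_pos (x : D) {z : E} (hz : z ∈ frameDomain E L x) :
    0 < h.normSq ⟨(chartAt E x).symm z, localFrame L x ((chartAt E x).symm z)⟩ :=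
  h.pos _ _ (localFrame_ne_zero x hz.2)

theorem contDiffAt_logFrameNormSq (x : D) {z : E} (hz : z ∈ frameDomain E L x) :
    ContDiffAt ℝ ∞ (h.logFrameNormSq x) z :=
  ((h.smooth x).contDiffAt ((isOpen_frameDomain x).mem_nhds hz)).log (h.normSq_frame_pos x hz).ne'

/-- In the trivialization a vector is `w e(z)`, and `‖w e‖² = |w|² ‖e‖²`. -/
theorem logNormSq_chart_symm (v : TotalSpace ℂ L) {q : E × ℂ} (hq : q.1 ∈ frameDomain E L v.1)
    (hq2 : q.2 ≠ 0) : h.logNormSq ((chartAt (ModelProd E ℂ) v).symm q)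
      = logNorm (h.logFrameNormSq v.1) q := by
  have e : (chartAt (ModelProd E ℂ) v).symm q
      = ⟨(chartAt E v.1).symm q.1, q.2 • localFrame L v.1 ((chartAt E v.1).symm q.1)⟩ := by
    rw [FiberBundle.chartedSpace_chartAt]
    change (trivializationAt ℂ L v.1).toOpenPartialHomeomorph.symm ((chartAt E v.1).symm q.1, q.2) = _
    rw [← trivialization_symm_eq_smul v.1 hq.2]
    exact (Trivialization.mk_symm _ hq.2 q.2).symm
  rw [e, logNormSq, normSq_smul, Real.log_mul (by simpa using hq2) (h.normSq_frame_pos v.1 hq).ne']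
  rfl

variable [FiniteDimensional ℂ E] [IsManifold 𝓘(ℂ, E) ω D]

/-- In the chart at `v`, `∂∂̄t` is `s` times the pullback of `θ`, so its connection and curvature
expression come from the base and `K` serves as the base bound. The remaining terms are controlled
by the profile equations. -/
theorem calabiCurvatureLE_of_profile {s : ℝ} (hs : s ^ 2 = 1) {θ : KahlerMetric E D}
    (hθ : h.CurvatureEq (-s) θ) {a : ℝ} (ha : 0 < a) (ha' : a ≤ 1 / 2) {φ f r : ℝ → ℝ}
    (hφ : IsProfile a s φ f r) {v : TotalSpace ℂ L} (hv : v.2 ≠ 0) (hv1 : h.normSq v < 1) {K : ℝ}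
    (hK0 : 0 ≤ K) (hK : CurvatureLE (chartForm θ.form v.1) (chartAt E v.1 v.1) K) :
    h.CalabiCurvatureLE φ v (K / |f (h.logNormSq v)| + (8 + 1 / a) * (1 + r (h.logNormSq v))) := by
  obtain ⟨f₁, f₂, f₃, hf⟩ := hφ.exists_derivs hs ha ha'
  set x := v.1 with hx
  set t : E × ℂ → ℝ := fun q => h.logNormSq ((chartAt (ModelProd E ℂ) v).symm q) with ht
  set q₀ : E × ℂ := chartAt (ModelProd E ℂ) v v with hq₀
  have hsabs : |s| = 1 := by
    have : |s| ^ 2 = 1 := by rw [sq_abs, hs]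
    nlinarith [abs_nonneg s]
  have hsc : (s : ℂ) ≠ 0 := by
    intro h0
    rw [Complex.ofReal_eq_zero] at h0
    simp [h0] at hs
  have hq : q₀ = (chartAt E x x, (trivializationAt ℂ L x v).2) := by
    rw [hq₀, FiberBundle.chartedSpace_chartAt]
    change (chartAt E x (trivializationAt ℂ L x v).1, _) = _
    rw [Trivialization.coe_fst' _ (mem_baseSet_trivializationAt ℂ L x)]
    rfl
  have hq1 : q₀.1 = chartAt E x x := by rw [hq]
  have hz : q₀.1 ∈ frameDomain E L x := by rw [hq1]; exact mem_frameDomain x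
  have hw : q₀.2 ≠ 0 := by
    rw [hq]
    intro h0
    apply hv
    have hb := mem_baseSet_trivializationAt ℂ L x
    have := Trivialization.symm_apply_apply_mk (trivializationAt ℂ L x) hb v.2
    have e : (trivializationAt ℂ L x ⟨x, v.2⟩).2 = 0 := h0
    rw [← this, e, trivialization_symm_eq_smul x hb, zero_smul]
  have ht0 : t q₀ = h.logNormSq v := by
    rw [ht, hq₀]
    simp only
    rw [(chartAt (ModelProd E ℂ) v).left_inv (mem_chart_source _ v)]
  have htneg : t q₀ < 0 := by
    rw [ht0]
    exact Real.log_neg (h.pos _ _ hv) hv1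
  have hdom : ∀ᶠ q : E × ℂ in 𝓝 q₀, q.1 ∈ frameDomain E L x ∧ q.2 ≠ 0 :=
    (continuousAt_fst.eventually ((isOpen_frameDomain x).mem_nhds hz)).and
      (continuousAt_snd.eventually_ne hw)
  have hψ : ∀ z ∈ frameDomain E L x, ∀ᶠ z in 𝓝 z, ContDiffAt ℝ ∞ (h.logFrameNormSq x) z := by
    intro z hz
    filter_upwards [(isOpen_frameDomain x).mem_nhds hz] with w hw
    exact h.contDiffAt_logFrameNormSq x hw
  -- Equality of germs at all nearby points is needed, since `∂∂̄t` is itself differentiated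
  -- afterwards.
  have hgerm : ∀ᶠ q in 𝓝 q₀, t =ᶠ[𝓝 q] logNorm (h.logFrameNormSq x) := by
    filter_upwards [hdom.eventually_nhds] with q hq
    filter_upwards [hq] with q' hq'
    exact h.logNormSq_chart_symm v hq'.1 hq'.2
  have htd : ∀ᶠ q in 𝓝 q₀, ContDiffAt ℝ ∞ t q := by
    filter_upwards [hdom, hgerm] with q h1 h2
    exact (contDiffAt_logNorm h1.2 (h.contDiffAt_logFrameNormSq x h1.1)).congr_of_eventuallyEq h2
  have hG : ∀ᶠ q in 𝓝 q₀, ∀ X Y, ddbar t q X Y = s * chartForm θ.form x q.1 X.1 Y.1 := by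
    filter_upwards [hdom, hgerm.eventually_nhds] with q h1 h2 X Y
    rw [← h.ddbar_logFrameNormSq hθ x h1.1, ← ddbar_logNorm h1.2 (hψ _ h1.1)]
    refine dHol_congr ?_ X
    filter_upwards [h2] with w hw
    refine dBar_congr ?_ Y
    filter_upwards [hw] with w' hw'
    rw [hw']
  have hτ : ∀ X, dHol (fun w => (t w : ℂ)) q₀ X
      = X.2 / q₀.2 + dHol (fun w => (h.logFrameNormSq x w : ℂ)) q₀.1 X.1 := by
    intro X
    rw [← dHol_logNorm hw (h.contDiffAt_logFrameNormSq x hz)]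
    refine dHol_congr ?_ X
    filter_upwards [hgerm.self_of_nhds] with w' hw'
    rw [hw']
  have hmet := θ.isMetricNear_chartForm x hz.1
  have hG0 := hG.self_of_nhds
  obtain ⟨Γ, hΓ⟩ := hmet.exists_connection
  have hdG : ∀ X Z W, dHol (fun w => ddbar t w Z W) q₀ X
      = s * dHol (fun w => chartForm θ.form x w Z.1 W.1) q₀.1 X.1 := by
    intro X Z W
    rw [dHol_congr (hG.mono fun w hw => hw Z W), dHol_const_mul]
    congr 1
    exact dHol_comp (c := Prod.fst) (F := fun w => chartForm θ.form x w Z.1 W.1)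
      (hmet.contDiffAt _ _).differentiableAt_infty hasFDerivAt_fst X
  have hddG : ∀ X Y Z W, dHol (fun w => dBar (fun w => ddbar t w Z W) w Y) q₀ X
      = s * dHol (fun w => dBar (fun w => chartForm θ.form x w Z.1 W.1) w Y.1) q₀.1 X.1 := by
    intro X Y Z W
    have e : (fun w => dBar (fun w => ddbar t w Z W) w Y) =ᶠ[𝓝 q₀] fun w =>
        s * dBar (fun w => chartForm θ.form x w Z.1 W.1) w.1 Y.1 := by
      filter_upwards [hG.eventually_nhds, continuousAt_fst.eventually hmet.eventually] with w h1 h2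
      rw [dBar_congr (h1.mono fun w hw => hw Z W), dBar_const_mul]
      congr 1
      exact dBar_comp (c := Prod.fst) (F := fun w => chartForm θ.form x w Z.1 W.1)
        (h2.contDiffAt _ _).differentiableAt_infty hasFDerivAt_fst Y
    rw [dHol_congr e, dHol_const_mul]
    congr 1
    exact dHol_comp (c := Prod.fst)
      (F := fun w => dBar (fun w => chartForm θ.form x w Z.1 W.1) w Y.1)
      (contDiffAt_dBar (hmet.contDiffAt _ _) _).differentiableAt_infty hasFDerivAt_fst X
  have hre : ∀ X, (ddbar t q₀ X X).re = s * (chartForm θ.form x q₀.1 X.1 X.1).re := by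
    intro X
    rw [hG0, Complex.re_ofReal_mul]
  have hneg : ∀ᶠ y in 𝓝 (t q₀), y < 0 := gt_mem_nhds htneg
  obtain ⟨df, df₁, df₂, hf1pos, hbound⟩ := hf _ htneg
  have hfpos := hφ.f_pos _ htneg
  -- `ν` is the Euler vector `w ∂/∂w`, for which `∂t = 1`. The fibre component of the lifted
  -- connection is set to `0`; any value would do, because `G` does not see it.
  have key := calabi_curvatureLE (z := q₀) (t := t) (φ := φ) (f := f) (f₁ := f₁) (f₂ := f₂)
    (f₃ := f₃ (t q₀)) htd (hneg.mono fun y hy => hφ.deriv_phi y hy)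
    (hneg.mono fun y hy => (hf y hy).1) (hneg.mono fun y hy => (hf y hy).2.1) df₂
    (ν := (0, q₀.2)) (by rw [hτ, dHol_zero_vec, add_zero]; exact div_self hw)
    (fun W => by rw [hG0, hmet.posHerm.zero_left, mul_zero])
    (Γ := fun X Z => (Γ X.1 Z.1, 0)) (fun X Z W => by rw [hG0, hdG, hΓ])
    (fun h0 => by rw [h0] at hfpos; simp at hfpos) hf1pos
    (fun X => by
      rw [hre, ← mul_assoc, mul_comm (f (t q₀)) s]
      exact mul_nonneg hfpos.le (hmet.posHerm.nonneg _))
    (fun X h1 h2 => by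
      have hX1 : X.1 = 0 := by
        by_contra hne
        have := hmet.posHerm.pos _ hne
        rw [hre, mul_eq_zero] at h1
        rcases h1 with h1 | h1
        · simp [h1] at hs
        · exact this.ne' h1
      rw [hτ, hX1, dHol_zero_vec, add_zero, div_eq_zero_iff, or_iff_left hw] at h2
      exact Prod.ext hX1 h2) (K := K)
    (fun X Y Z W => by
      have hh := hK X.1 Y.1 Z.1 W.1
      rw [← hq1, hmet.curvatureTensor_eq hΓ] at hh
      have hl : ∀ X : E × ℂ, Real.sqrt |(ddbar t q₀ X X).re|
          = len (chartForm θ.form x) q₀.1 X.1 := by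
        intro X
        rw [hre, abs_mul, hsabs, one_mul, abs_of_nonneg (hmet.posHerm.nonneg _), len]
      rw [hl, hl, hl, hl, hddG, hG0, ← mul_neg, ← mul_add, norm_mul, Complex.norm_real,
        Real.norm_eq_abs, hsabs, one_mul]
      exact hh) hK0
  refine CurvatureLE.mono key ?_
  rw [← ht0]
  linarith

end HermitianMetric

end TotalSpaceCharts

end CalabiModel

end

/-! ### The two curvature estimates -/

theorem lemma3p1 {E : Type*} [NormedAddCommGroup E] [NormedSpace ℂ E] [FiniteDimensional ℂ E]
    {D : Type*} [TopologicalSpace D] [T2Space D] [CompactSpace D]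
    [ChartedSpace E D] [IsManifold 𝓘(ℂ, E) ω D]
    {L : D → Type*} [TopologicalSpace (TotalSpace ℂ L)] [∀ x, AddCommGroup (L x)]
    [∀ x, Module ℂ (L x)] [∀ x, TopologicalSpace (L x)] [FiberBundle ℂ L] [VectorBundle ℂ ℂ L]
    [ContMDiffVectorBundle ω ℂ L 𝓘(ℂ, E)]
    (n : ℕ) (hn : n = Module.finrank ℂ E + 1)
    (θ : CalabiModel.KahlerMetric E D) (h : CalabiModel.HermitianMetric E L)
    (hRic : θ.RicciFlat) :
    (h.CurvatureEq (-1) θ → θ.Flat →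
      ∃ C : ℝ, ∀ β : ℝ, 0 < β → ∀ v : TotalSpace ℂ L, v.2 ≠ 0 → h.normSq v < 1 →
        h.CalabiCurvatureLE (CalabiModel.phiNeg n β) v C) ∧
    (h.CurvatureEq 1 θ →
      ∃ C : ℝ, ∀ β : ℝ, 0 < β → ∀ v : TotalSpace ℂ L, v.2 ≠ 0 → h.normSq v < 1 →
        h.CalabiCurvatureLE (CalabiModel.phiPos n β) v
          (C * (1 / (1 - Real.exp (-CalabiModel.phiPos n β (h.logNormSq v)))
            + 1 / (β * (1 - Real.exp (-CalabiModel.phiPos n β (h.logNormSq v)))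
                ^ (1 / ((n : ℝ) + 1)))))) := by
  have hn1 : 1 ≤ n := by omega
  have hn' : (1 : ℝ) ≤ n := by exact_mod_cast hn1
  have ha : (0 : ℝ) < 1 / ((n : ℝ) + 1) := by positivity
  have ha' : 1 / ((n : ℝ) + 1) ≤ 1 / 2 := by
    apply one_div_le_one_div_of_le <;> linarith
  set a := 1 / ((n : ℝ) + 1) with hadef
  have hc : 0 < 8 + 1 / a := by positivity
  constructor
  · intro hσ hflat
    -- Flatness gives `K = 0`, and `1 + q ≤ 2`.
    refine ⟨(8 + 1 / a) * 2, fun β hβ v hv hv1 => ?_⟩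
    obtain ⟨f, q, hprof, hq⟩ := CalabiModel.isProfile_phiNeg n hβ
    have key := h.calabiCurvatureLE_of_profile (s := 1) (by norm_num) hσ ha ha' hprof hv hv1 (K := 0)
      le_rfl (fun X Y Z W => by
        rw [hflat v.1 _ (mem_chart_target E v.1)]
        simp)
    refine CalabiModel.CurvatureLE.mono key ?_
    rw [zero_div, zero_add]
    exact mul_le_mul_of_nonneg_left (by linarith [hq (h.logNormSq v)]) hc.le
  · intro hσ
    obtain ⟨K, hK0, hK⟩ := θ.exists_curvatureLE
    -- With `P = 1 - e^{-φ} ≤ 1`, the base term is `K / (β P^a)`, and `1 + q = 1 + 1/P ≤ 2/P`.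
    refine ⟨K + (8 + 1 / a) * 2, fun β hβ v hv hv1 => ?_⟩
    obtain ⟨hpos, hprof⟩ := CalabiModel.isProfile_phiPos n hn1 hβ
    have key := h.calabiCurvatureLE_of_profile (s := -1) (by norm_num) (by rwa [neg_neg]) ha ha'
      hprof hv hv1 hK0 (hK v.1)
    refine CalabiModel.CurvatureLE.mono key ?_
    have ht : h.logNormSq v < 0 := Real.log_neg (h.pos _ _ hv) hv1
    have hP := CalabiModel.posBase_pos (hpos _ ht)
    have hP1 : 1 - Real.exp (-CalabiModel.phiPos n β (h.logNormSq v)) ≤ 1 := by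
      linarith [Real.exp_pos (-CalabiModel.phiPos n β (h.logNormSq v))]
    set P := 1 - Real.exp (-CalabiModel.phiPos n β (h.logNormSq v)) with hPdef
    have hPa : 0 < P ^ a := Real.rpow_pos_of_pos hP a
    have h1 : 1 ≤ 1 / P := by rw [le_div_iff₀ hP]; linarith
    have habs : |-β * P ^ a| = β * P ^ a := by
      rw [abs_mul, abs_neg, abs_of_pos hβ, abs_of_pos hPa]
    rw [habs, div_eq_mul_one_div K]
    have h2 : 0 < 1 / (β * P ^ a) := by positivity
    nlinarith [mul_nonneg hK0 (zero_le_one.trans h1), mul_pos hc h2,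
      mul_nonneg hc.le (sub_nonneg.2 h1)]
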